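/- All Banach spaces are real, and $c_{00}$ denotes the finitely supported real sequences. For sequences $(v_i)$, $(y_i)$ in Banach spaces and $C<\infty$, we say that $(v_i)$ *$C$-dominates* $(y_i)$ if $\|\sum a_i y_i\|\le C$ for all $(a_i)\in c_{00}$ with $\|\sum a_i v_i\|\le 1$; $(v_i)$ *dominates* $(y_i)$ if it $C$-dominates $(y_i)$ for some $C<\infty$; the two sequences are *equivalent* if each dominates the other. A sequence $(v_i)$ is *basic* if it is a Schauder basis of its closed linear span, *normalized* if $\|v_i\|=1$ for all $i$, and *1-suppression unconditional* if $\|\sum_{i\in A}a_iv_i\|\le\|\sum a_iv_i\|$ for all $(a_i)\in c_{00}$ and $A\subset\mathbb N$. A Banach space $X$ is $U_{(v_i)}$ if there is a constant $C<\infty$ such that every normalized weakly null sequence in $X$ has a subsequence that is $C$-dominated by $(v_i)$. Tsirelson's space $T$ is the completion of $c_{00}$ under the unique norm satisfying $$\|x\|=\max\Bigl(\|x\|_\infty,\ \sup\Bigl\{\tfrac12\sum_{i=1}^n\|E_i x\| : n\in\mathbb N,\ E_1,\dots,E_n\subset\mathbb N \text{ finite},\ n\le E_1<E_2<\dots<E_n\Bigr\}\Bigr),$$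 where $E x$ is the restriction of $x$ to $E$ (and $n\le E_1$ means $n\le\min E_1$, $E<F$ means $\max E<\min F$). Let $(t_i)$ be the unit vector basis of $T$ and $(t_i^*)\subset T^*$ the functionals biorthogonal to $(t_i)$. **Lemma 5.7.** Let $(v_i)$ be a 1-suppression unconditional normalized basic sequence in a Banach space such that for every strictly increasing sequence $(k_i)$ of positive integers $(v_{k_i})$ dominates $(v_i)$, and suppose that $(v_i)$ is not equivalent to the unit vector basis of $c_0$. Then there exists a reflexive Banach space $X$ which is $U_{(v_i)}$ and not $U_{(t_i^*)}$. -/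

import Mathlib

open Filter Topology

namespace UpperEstimate

/-! ### Sequences in Banach spaces

Sequences are indexed by `ℕ = {0, 1, 2, …}`, so the term `v i` is the `(i + 1)`-st term of the
sequence `(v_1, v_2, …)`.  Finitely supported sequences of scalars (`c₀₀`) are elements of `ℕ →₀ ℝ`,
and `Finsupp.linearCombination ℝ v a` is the finite sum `∑ a_i v_i`. -/

section Sequences

variable {V W : Type*} [NormedAddCommGroup V] [NormedSpace ℝ V]
  [NormedAddCommGroup W] [NormedSpace ℝ W]

/-- A basic sequence: a sequence that is a Schauder basis of its closed linear span. -/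
def IsBasicSequence (v : ℕ → V) : Prop :=
  ∃ b : SchauderBasis ℝ (Submodule.span ℝ (Set.range v)).topologicalClosure,
    ∀ i, (b.basis i : V) = v i

/-- All terms have norm one. -/
def IsNormalized (v : ℕ → V) : Prop := ∀ i, ‖v i‖ = 1

/-- `1`-suppression unconditional: `‖∑_{i ∈ A} a_i v_i‖ ≤ ‖∑ a_i v_i‖` for all `A` and all
finitely supported `a`. -/
def IsOneSuppressionUnconditional (v : ℕ → V) : Prop :=
  ∀ (a : ℕ →₀ ℝ) (A : Finset ℕ),
    ‖Finsupp.linearCombination ℝ v (a.filter (· ∈ A))‖ ≤ ‖Finsupp.linearCombination ℝ v a‖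

/-- `v` `C`-dominates `y` (`y` has a `C`-upper `v`-estimate):
`‖∑ a_i y_i‖ ≤ C` for all finitely supported `a` with `‖∑ a_i v_i‖ ≤ 1`. -/
def CDominates (C : ℝ) (v : ℕ → V) (y : ℕ → W) : Prop :=
  ∀ a : ℕ →₀ ℝ, ‖Finsupp.linearCombination ℝ v a‖ ≤ 1 → ‖Finsupp.linearCombination ℝ y a‖ ≤ C

/-- `v` dominates `y`. -/
def Dominates (v : ℕ → V) (y : ℕ → W) : Prop := ∃ C : ℝ, CDominates C v y

/-- Equivalence of sequences: each dominates the other. -/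
def IsEquivalentTo (v : ℕ → V) (y : ℕ → W) : Prop := Dominates v y ∧ Dominates y v

/-- Weak convergence to `0`. -/
def IsWeaklyNull (x : ℕ → V) : Prop :=
  ∀ f : StrongDual ℝ V, Tendsto (fun n => f (x n)) atTop (𝓝 0)

end Sequences

/-- The property `U_{(v_i)}` of the space `X`: there is one constant `C` such that every normalized
weakly null sequence in `X` has a subsequence that is `C`-dominated by `v`. -/
def HasU {V : Type*} [NormedAddCommGroup V] [NormedSpace ℝ V] (v : ℕ → V)
    (X : Type*) [NormedAddCommGroup X] [NormedSpace ℝ X] : Prop :=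
  ∃ C : ℝ, ∀ x : ℕ → X, IsNormalized x → IsWeaklyNull x →
    ∃ k : ℕ → ℕ, StrictMono k ∧ CDominates C v (x ∘ k)

/-- Reflexivity: the canonical embedding into the bidual is onto. -/
def IsReflexiveSpace (X : Type*) [NormedAddCommGroup X] [NormedSpace ℝ X] : Prop :=
  Function.Surjective (NormedSpace.inclusionInDoubleDual ℝ X)

/-- The unit vector basis of `c₀`, the Banach space of null sequences with the supremum norm. -/
noncomputable def c0Basis (i : ℕ) : ZeroAtInftyContinuousMap ℕ ℝ where
  toFun := Pi.single i 1
  continuous_toFun := continuous_of_discreteTopology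
  zero_at_infty' := by
    rw [Filter.cocompact_eq_cofinite]
    refine tendsto_const_nhds.congr' ?_
    have : ({i} : Set ℕ)ᶜ ∈ (Filter.cofinite : Filter ℕ) := (Set.finite_singleton i).compl_mem_cofinite
    filter_upwards [this] with j hj
    exact (Pi.single_eq_of_ne (M := fun _ => ℝ) hj 1).symm

/-! ### Tsirelson's space -/

/-- `n ≤ E_1 < E_2 < … < E_n`.  The index `a : ℕ` stands for the `(a + 1)`-st coordinate,
whence `n ≤ a + 1`.  Empty sets are allowed; they contribute nothing to the sums below. -/
def IsAdmissible (n : ℕ) (E : Fin n → Finset ℕ) : Prop :=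
  (∀ i, ∀ a ∈ E i, n ≤ a + 1) ∧ ∀ i j, i < j → ∀ a ∈ E i, ∀ b ∈ E j, a < b

/-- `N` satisfies Tsirelson's implicit relation
`N x = max (‖x‖_∞) (sup { (1/2) ∑_{i=1}^n N (E_i x) : n ≤ E_1 < … < E_n })` on `c₀₀`, where `E x` is
the restriction of `x` to `E`. -/
def IsTsirelsonNorm (N : (ℕ →₀ ℝ) → ℝ) : Prop :=
  ∀ x : ℕ →₀ ℝ, IsLUB
    (Set.range (fun i => |x i|) ∪
      {r | ∃ (n : ℕ) (E : Fin n → Finset ℕ), IsAdmissible n E ∧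
        r = (1 / 2) * ∑ i, N (x.filter (· ∈ E i))}) (N x)

/-- The `k`-th approximation of Tsirelson's norm. -/
noncomputable def tsirelsonIter : ℕ → (ℕ →₀ ℝ) → ℝ
  | 0, x => ⨆ i, |x i|
  | k + 1, x => max (tsirelsonIter k x)
      (⨆ F : {F : Σ n, (Fin n → Finset ℕ) // IsAdmissible F.1 F.2},
        (1 / 2) * ∑ i, tsirelsonIter k (x.filter (· ∈ F.1.2 i)))

/-- Tsirelson's norm on `c₀₀`, in the construction of Figiel and Johnson.  It is the only solution
of the implicit relation, see `isTsirelsonNorm_tsirelsonNorm` and `IsTsirelsonNorm.unique`. -/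
noncomputable def tsirelsonNorm (x : ℕ →₀ ℝ) : ℝ := ⨆ k, tsirelsonIter k x

lemma bddAbove_coord (x : ℕ →₀ ℝ) : BddAbove (Set.range fun i => |x i|) := by
  refine ⟨∑ i ∈ x.support, |x i|, ?_⟩
  rintro _ ⟨i, rfl⟩
  by_cases h : i ∈ x.support
  · exact Finset.single_le_sum (f := fun i => |x i|) (fun _ _ => abs_nonneg _) h
  · simp only [Finsupp.mem_support_iff, not_not] at h
    simp only [h, abs_zero]
    positivity

lemma sum_l1_filter_le {n : ℕ} {E : Fin n → Finset ℕ} (hE : IsAdmissible n E) (x : ℕ →₀ ℝ) :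
    ∑ i, ∑ a ∈ (x.filter (· ∈ E i)).support, |x.filter (· ∈ E i) a| ≤ ∑ a ∈ x.support, |x a| := by
  have h1 : ∀ i, ∑ a ∈ (x.filter (· ∈ E i)).support, |x.filter (· ∈ E i) a|
      = ∑ a ∈ x.support.filter (· ∈ E i), |x a| := by
    intro i
    rw [Finsupp.support_filter]
    refine Finset.sum_congr rfl fun a ha => ?_
    rw [Finsupp.filter_apply_pos _ _ (Finset.mem_filter.1 ha).2]
  simp_rw [h1]
  rw [← Finset.sum_biUnion]
  · refine Finset.sum_le_sum_of_subset_of_nonneg ?_ fun _ _ _ => abs_nonneg _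
    exact Finset.biUnion_subset.2 fun i _ => Finset.filter_subset _ _
  · intro i _ j _ hij
    rw [Function.onFun, Finset.disjoint_left]
    intro a ha hb
    have ha := (Finset.mem_filter.1 ha).2
    have hb := (Finset.mem_filter.1 hb).2
    rcases lt_or_gt_of_ne hij with h | h
    · exact lt_irrefl _ (hE.2 i j h a ha a hb)
    · exact lt_irrefl _ (hE.2 j i h a hb a ha)

lemma tsirelsonIter_nonneg (k : ℕ) (x : ℕ →₀ ℝ) : 0 ≤ tsirelsonIter k x := by
  induction k with
  | zero => exact Real.iSup_nonneg fun _ => abs_nonneg _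
  | succ k ih => exact le_max_of_le_left ih

lemma tsirelsonIter_le_l1 (k : ℕ) (x : ℕ →₀ ℝ) :
    tsirelsonIter k x ≤ ∑ a ∈ x.support, |x a| := by
  induction k generalizing x with
  | zero =>
    refine ciSup_le fun i => ?_
    by_cases h : i ∈ x.support
    · exact Finset.single_le_sum (f := fun i => |x i|) (fun _ _ => abs_nonneg _) h
    · simp only [Finsupp.mem_support_iff, not_not] at h
      simp only [h, abs_zero]
      positivity
  | succ k ih =>
    refine max_le (ih x) (Real.iSup_le (fun F => ?_) (by positivity))
    have h1 := Finset.sum_le_sum fun i (_ : i ∈ Finset.univ) => ih (x.filter (· ∈ F.1.2 i))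
    have h2 := sum_l1_filter_le F.2 x
    have h3 : 0 ≤ ∑ a ∈ x.support, |x a| := by positivity
    linarith

lemma bddAbove_admissible (k : ℕ) (x : ℕ →₀ ℝ) :
    BddAbove (Set.range fun F : {F : Σ n, (Fin n → Finset ℕ) // IsAdmissible F.1 F.2} =>
      (1 / 2) * ∑ i, tsirelsonIter k (x.filter (· ∈ F.1.2 i))) := by
  refine ⟨∑ a ∈ x.support, |x a|, ?_⟩
  rintro _ ⟨F, rfl⟩
  have h1 := Finset.sum_le_sum
    fun i (_ : i ∈ Finset.univ) => tsirelsonIter_le_l1 k (x.filter (· ∈ F.1.2 i))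
  have h2 := sum_l1_filter_le F.2 x
  have h3 : 0 ≤ ∑ a ∈ x.support, |x a| := by positivity
  dsimp only
  linarith

lemma bddAbove_iter (x : ℕ →₀ ℝ) : BddAbove (Set.range fun k => tsirelsonIter k x) := by
  refine ⟨∑ a ∈ x.support, |x a|, ?_⟩
  rintro _ ⟨k, rfl⟩
  exact tsirelsonIter_le_l1 k x

lemma tsirelsonIter_mono (x : ℕ →₀ ℝ) : Monotone fun k => tsirelsonIter k x :=
  monotone_nat_of_le_succ fun _ => le_max_left _ _

lemma tsirelsonIter_le_norm (k : ℕ) (x : ℕ →₀ ℝ) : tsirelsonIter k x ≤ tsirelsonNorm x :=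
  le_ciSup (bddAbove_iter x) k

lemma tendsto_tsirelsonIter (x : ℕ →₀ ℝ) :
    Tendsto (fun k => tsirelsonIter k x) atTop (𝓝 (tsirelsonNorm x)) :=
  tendsto_atTop_ciSup (tsirelsonIter_mono x) (bddAbove_iter x)

lemma abs_coord_le_tsirelsonNorm (x : ℕ →₀ ℝ) (i : ℕ) : |x i| ≤ tsirelsonNorm x :=
  (le_ciSup (bddAbove_coord x) i).trans (tsirelsonIter_le_norm 0 x)

/-- Tsirelson's norm satisfies the implicit relation. -/
theorem isTsirelsonNorm_tsirelsonNorm : IsTsirelsonNorm tsirelsonNorm := by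
  intro x
  constructor
  · rintro r (⟨i, rfl⟩ | ⟨n, E, hE, rfl⟩)
    · exact abs_coord_le_tsirelsonNorm x i
    · have h : Tendsto (fun k => (1 / 2 : ℝ) * ∑ i, tsirelsonIter k (x.filter (· ∈ E i))) atTop
          (𝓝 ((1 / 2) * ∑ i, tsirelsonNorm (x.filter (· ∈ E i)))) :=
        (tendsto_finsetSum _ fun i _ => tendsto_tsirelsonIter _).const_mul _
      refine le_of_tendsto' h fun k => le_trans ?_ (tsirelsonIter_le_norm (k + 1) x)
      exact le_max_of_le_right (le_ciSup (bddAbove_admissible k x) ⟨⟨n, E⟩, hE⟩)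
  · intro M hM
    have hM0 : 0 ≤ M := (abs_nonneg _).trans (hM (Or.inl ⟨0, rfl⟩))
    refine ciSup_le fun k => ?_
    induction k with
    | zero => exact ciSup_le fun i => hM (Or.inl ⟨i, rfl⟩)
    | succ k ih =>
      refine max_le ih (Real.iSup_le (fun F => ?_) hM0)
      refine le_trans ?_ (hM (Or.inr ⟨F.1.1, F.1.2, F.2, rfl⟩))
      gcongr
      exact tsirelsonIter_le_norm _ _

/-- The implicit relation has at most one solution. -/
theorem IsTsirelsonNorm.unique {N M : (ℕ →₀ ℝ) → ℝ} (hN : IsTsirelsonNorm N)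
    (hM : IsTsirelsonNorm M) : N = M := by
  have nonneg : ∀ {N : (ℕ →₀ ℝ) → ℝ}, IsTsirelsonNorm N → ∀ x, 0 ≤ N x := fun h x =>
    (abs_nonneg _).trans ((h x).1 (Or.inl ⟨0, rfl⟩))
  have zero : ∀ {N : (ℕ →₀ ℝ) → ℝ}, IsTsirelsonNorm N → N 0 = 0 := by
    intro N h
    have h3 := (h 0).1 (Or.inr ⟨3, fun _ => ∅, ⟨by simp, by simp⟩, rfl⟩)
    have h0 := nonneg h 0
    simp only [Finsupp.filter_zero, Finset.sum_const, Finset.card_univ, Fintype.card_fin,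
      nsmul_eq_mul, Nat.cast_ofNat] at h3
    linarith
  have key : ∀ (m : ℕ) (N M : (ℕ →₀ ℝ) → ℝ), IsTsirelsonNorm N → IsTsirelsonNorm M →
      ∀ x : ℕ →₀ ℝ, x.support.card = m → N x ≤ M x := by
    intro m
    induction m using Nat.strong_induction_on with
    | _ m ih =>
    intro N M hN hM x hx
    have hle : N x ≤ max (M x) (N x / 2) := by
      refine (hN x).2 ?_
      rintro r (⟨i, rfl⟩ | ⟨n, E, hE, rfl⟩)
      · exact le_max_of_le_left ((hM x).1 (Or.inl ⟨i, rfl⟩))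
      · by_cases hall : ∀ i, (x.filter (· ∈ E i)).support.card < m
        · refine le_max_of_le_left (le_trans ?_ ((hM x).1 (Or.inr ⟨n, E, hE, rfl⟩)))
          gcongr with i
          exact ih _ (hall i) N M hN hM _ rfl
        · push Not at hall
          obtain ⟨i, hi⟩ := hall
          have hsupp : x.support.filter (· ∈ E i) = x.support :=
            Finset.eq_of_subset_of_card_le (Finset.filter_subset _ _)
              (by rw [hx]; simpa [Finsupp.support_filter] using hi)
          have hmem : ∀ a ∈ x.support, a ∈ E i := fun a ha =>
            (Finset.mem_filter.1 (hsupp.symm ▸ ha : a ∈ x.support.filter (· ∈ E i))).2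
          refine le_max_of_le_right ?_
          rw [Finset.sum_eq_single i]
          · have : x.filter (· ∈ E i) = x := by
              rw [Finsupp.filter_eq_self_iff]
              exact fun a ha => hmem a (Finsupp.mem_support_iff.2 ha)
            rw [this]
            linarith
          · intro j _ hji
            have : x.filter (· ∈ E j) = 0 := by
              rw [Finsupp.filter_eq_zero_iff]
              intro a ha
              by_contra hne
              have hai := hmem a (Finsupp.mem_support_iff.2 hne)
              rcases lt_or_gt_of_ne hji with h | h
              · exact lt_irrefl _ (hE.2 j i h a ha a hai)
              · exact lt_irrefl _ (hE.2 i j h a hai a ha)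
            rw [this, zero hN]
          · simp
    have h0 := nonneg hN x
    rcases le_max_iff.1 hle with h | h
    · exact h
    · linarith [nonneg hM x]
  funext x
  exact le_antisymm (key _ N M hN hM x rfl) (key _ M N hM hN x rfl)

lemma tsirelsonIter_smul (k : ℕ) (c : ℝ) (x : ℕ →₀ ℝ) :
    tsirelsonIter k (c • x) = |c| * tsirelsonIter k x := by
  induction k generalizing x with
  | zero =>
    simp only [tsirelsonIter, Finsupp.smul_apply, smul_eq_mul, abs_mul]
    exact (Real.mul_iSup_of_nonneg (abs_nonneg c) _).symm
  | succ k ih =>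
    simp only [tsirelsonIter, Finsupp.filter_smul, ih]
    rw [mul_max_of_nonneg _ _ (abs_nonneg c), Real.mul_iSup_of_nonneg (abs_nonneg c)]
    congr 2
    funext F
    rw [← Finset.mul_sum]
    ring

lemma tsirelsonIter_add_le (k : ℕ) (x y : ℕ →₀ ℝ) :
    tsirelsonIter k (x + y) ≤ tsirelsonIter k x + tsirelsonIter k y := by
  induction k generalizing x y with
  | zero =>
    refine ciSup_le fun i => (abs_add_le _ _).trans ?_
    exact add_le_add (le_ciSup (bddAbove_coord x) i) (le_ciSup (bddAbove_coord y) i)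
  | succ k ih =>
    refine max_le ((ih x y).trans (add_le_add (le_max_left _ _) (le_max_left _ _))) ?_
    refine Real.iSup_le (fun F => ?_)
      (add_nonneg (tsirelsonIter_nonneg (k + 1) x) (tsirelsonIter_nonneg (k + 1) y))
    have h1 := Finset.sum_le_sum fun i (_ : i ∈ Finset.univ) =>
      ih (x.filter (· ∈ F.1.2 i)) (y.filter (· ∈ F.1.2 i))
    rw [Finset.sum_add_distrib] at h1
    simp only [← Finsupp.filter_add] at h1
    have hx := (le_ciSup (bddAbove_admissible k x) F).trans (le_max_right (tsirelsonIter k x) _)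
    have hy := (le_ciSup (bddAbove_admissible k y) F).trans (le_max_right (tsirelsonIter k y) _)
    simp only [tsirelsonIter]
    linarith

lemma tsirelsonNorm_smul (c : ℝ) (x : ℕ →₀ ℝ) :
    tsirelsonNorm (c • x) = |c| * tsirelsonNorm x := by
  simp only [tsirelsonNorm, tsirelsonIter_smul]
  exact (Real.mul_iSup_of_nonneg (abs_nonneg c) _).symm

lemma tsirelsonNorm_add_le (x y : ℕ →₀ ℝ) :
    tsirelsonNorm (x + y) ≤ tsirelsonNorm x + tsirelsonNorm y :=
  ciSup_le fun k => (tsirelsonIter_add_le k x y).trans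
    (add_le_add (tsirelsonIter_le_norm k x) (tsirelsonIter_le_norm k y))

/-- `c₀₀`, as the carrier of Tsirelson's norm. -/
def TsirelsonPre : Type := ℕ →₀ ℝ

noncomputable instance : AddCommGroup TsirelsonPre := inferInstanceAs (AddCommGroup (ℕ →₀ ℝ))

noncomputable instance : Module ℝ TsirelsonPre := inferInstanceAs (Module ℝ (ℕ →₀ ℝ))

noncomputable instance : Norm TsirelsonPre := ⟨fun x => tsirelsonNorm x⟩

theorem tsirelsonPre_core : NormedSpace.Core ℝ TsirelsonPre where
  norm_nonneg x := (abs_nonneg _).trans (abs_coord_le_tsirelsonNorm x 0)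
  norm_smul c x := tsirelsonNorm_smul c x
  norm_triangle x y := tsirelsonNorm_add_le x y
  norm_eq_zero_iff x := by
    constructor
    · intro h
      refine Finsupp.ext fun i => abs_nonpos_iff.1 ?_
      exact (abs_coord_le_tsirelsonNorm x i).trans h.le
    · rintro rfl
      have h := tsirelsonNorm_smul 0 (0 : ℕ →₀ ℝ)
      rw [zero_smul, abs_zero, zero_mul] at h
      exact h

noncomputable instance : NormedAddCommGroup TsirelsonPre :=
  NormedAddCommGroup.ofCore tsirelsonPre_core

noncomputable instance : NormedSpace ℝ TsirelsonPre := NormedSpace.ofCore tsirelsonPre_core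

/-- Tsirelson's space `T`: the completion of `c₀₀` under Tsirelson's norm. -/
abbrev TsirelsonSpace : Type := UniformSpace.Completion TsirelsonPre

/-- The unit vector basis `(t_i)` of `T`. -/
noncomputable def tsirelsonBasis (i : ℕ) : TsirelsonSpace :=
  UniformSpace.Completion.coe' (α := TsirelsonPre) (Finsupp.single i 1 : ℕ →₀ ℝ)

/-- The coordinate functional `x ↦ x_i` on `c₀₀` with Tsirelson's norm. -/
noncomputable def tsirelsonPreCoord (i : ℕ) : StrongDual ℝ TsirelsonPre :=
  LinearMap.mkContinuous (Finsupp.lapply i : (ℕ →₀ ℝ) →ₗ[ℝ] ℝ) 1 fun x => by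
    rw [one_mul]
    exact abs_coord_le_tsirelsonNorm x i

/-- The functionals `(t_i^*)` biorthogonal to `(t_i)`, a sequence in the dual space `T^*`:
`t_i^*` is the continuous extension of the `i`-th coordinate functional. -/
noncomputable def tsirelsonDualBasis (i : ℕ) : StrongDual ℝ TsirelsonSpace :=
  (tsirelsonPreCoord i).extend (UniformSpace.Completion.toComplL : TsirelsonPre →L[ℝ] TsirelsonSpace)

/-- On `c₀₀` the functional `t_i^*` is the `i`-th coordinate. -/
theorem tsirelsonDualBasis_coe (i : ℕ) (x : ℕ →₀ ℝ) :
    tsirelsonDualBasis i (UniformSpace.Completion.coe' (α := TsirelsonPre) x) = x i :=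
  ContinuousLinearMap.extend_eq (f := tsirelsonPreCoord i)
    (e := (UniformSpace.Completion.toComplL : TsirelsonPre →L[ℝ] TsirelsonSpace))
    UniformSpace.Completion.denseRange_coe
    (UniformSpace.Completion.isUniformInducing_coe TsirelsonPre) x

/-- Biorthogonality of `(t_i)` and `(t_i^*)`. -/
theorem tsirelsonDualBasis_basis (i j : ℕ) :
    tsirelsonDualBasis i (tsirelsonBasis j) = if j = i then 1 else 0 := by
  rw [tsirelsonBasis, tsirelsonDualBasis_coe, Finsupp.single_apply]

end UpperEstimate

/-! The space `X` is the dual of `c₀₀` under a mixed Tsirelson norm in which up to `N j` successive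
pieces may be added with weight `2^{-(j+1)}`. Completing `c₀₀` would not change the dual. By
duality, a combination of at most `N j` successive blocks from the unit ball of `X`, with
coefficients bounded by `c`, has norm at most `c 2^{j+1}` (`norm_sum_smul_comp_restrict_le`).
Everything rests on choosing `N` to grow fast enough.

Upper `v`-estimates: since subsequences of `v` dominate `v` and `v` is not the `c₀` basis, `‖∑_{i ∈
A} v_i‖` tends to infinity uniformly in the cardinality of `A` (`exists_card_le_of_norm_sum_le`).
Hence the number of coordinates above a given level is bounded over the unit ball
(`exists_card_filter_le`). Let `N j` exceed this bound for the level `4^{-(j+1)}`. Coefficients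
between `4^{-(J+1)}` and `4^{-J}` then contribute at most `4^{-J} 2^{J+1}`, which is summable in
`J`. Weakly null sequences have subsequences close to blocks, so `hasU_dual` follows.

Reflexivity: adding a long average of later blocks to a vector cannot nearly double its norm, so the
unit vector basis is shrinking (`tendsto_norm_comp_tail`). If also `4^j ≤ N j`, then `4^j` blocks of
the dual sum to norm at most `2^{j+1}`, so the biorthogonal functionals are shrinking too
(`tendsto_norm_comp_dualTail`). The canonical image of `c₀₀` is therefore dense in its bidual, which
yields `isReflexiveSpace_dual`.

Failure of `U_{(t_i^*)}`: sums of `n` functionals `t_i^*` supported beyond `n` have norm at most 2.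
Domination would bound the sum of `n` members of a subsequence of the coordinate functionals.
Evaluating that sum at the matching unit vectors gives `n`, whereas the sum of these vectors has
norm `o(n)` (`exists_norm_sum_mixedUnit_le`). -/

namespace UpperEstimate

/-! ### A mixed Tsirelson norm on `c₀₀` -/

/-- Finite sets `I 0 < I 1 < I 2 < …`; empty sets are allowed. -/
def IsSuccessive (I : ℕ → Finset ℕ) : Prop :=
  ∀ s t, s < t → ∀ a ∈ I s, ∀ b ∈ I t, a < b

lemma IsSuccessive.eq_of_mem {I : ℕ → Finset ℕ} (hI : IsSuccessive I) {s t a : ℕ}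
    (hs : a ∈ I s) (ht : a ∈ I t) : s = t := by
  by_contra h
  rcases lt_or_gt_of_ne h with h | h
  · exact lt_irrefl _ (hI s t h a hs a ht)
  · exact lt_irrefl _ (hI t s h a ht a hs)

lemma isSuccessive_Ico {m : ℕ → ℕ} (hm : Monotone m) :
    IsSuccessive fun i => Finset.Ico (m i) (m (i + 1)) := by
  intro s t hst a ha b hb
  have := hm (Nat.succ_le_of_lt hst)
  simp only [Finset.mem_Ico, Nat.succ_eq_add_one] at *
  omega

/-- The families of successive sets over which the mixed Tsirelson norm takes suprema: a weight
index `j`, at most `N j` indices, and a successive sequence of sets. -/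
abbrev BlockFamily (N : ℕ → ℕ) : Type :=
  {F : ℕ × Finset ℕ × (ℕ → Finset ℕ) // F.2.1.card ≤ N F.1 ∧ IsSuccessive F.2.2}

/-- The approximations of the mixed Tsirelson norm. -/
noncomputable def mixedIter (N : ℕ → ℕ) : ℕ → (ℕ →₀ ℝ) → ℝ
  | 0, x => ⨆ i, |x i|
  | k + 1, x => max (mixedIter N k x)
      (⨆ F : BlockFamily N,
        (1 / 2) ^ (F.1.1 + 1) * ∑ i ∈ F.1.2.1, mixedIter N k (x.filter (· ∈ F.1.2.2 i)))

/-- The norm on `c₀₀` given by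
`‖x‖ = max (‖x‖_∞) (sup { 2^{-(j+1)} ∑_{i ∈ B} ‖I_i x‖ : j, |B| ≤ N j, (I_i) successive })`. -/
noncomputable def mixedNorm (N : ℕ → ℕ) (x : ℕ →₀ ℝ) : ℝ := ⨆ k, mixedIter N k x

/-- Successive sets are disjoint. This `ℓ₁` bound makes all the suprema that define the norm finite.
-/
lemma sum_abs_filter_le {I : ℕ → Finset ℕ} (hI : IsSuccessive I) (B : Finset ℕ) (x : ℕ →₀ ℝ) :
    ∑ i ∈ B, ∑ a ∈ (x.filter (· ∈ I i)).support, |x.filter (· ∈ I i) a|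
      ≤ ∑ a ∈ x.support, |x a| := by
  have h1 : ∀ i, ∑ a ∈ (x.filter (· ∈ I i)).support, |x.filter (· ∈ I i) a|
      = ∑ a ∈ x.support.filter (· ∈ I i), |x a| := by
    intro i
    rw [Finsupp.support_filter]
    refine Finset.sum_congr rfl fun a ha => ?_
    rw [Finsupp.filter_apply_pos _ _ (Finset.mem_filter.1 ha).2]
  simp_rw [h1]
  rw [← Finset.sum_biUnion]
  · refine Finset.sum_le_sum_of_subset_of_nonneg ?_ fun _ _ _ => abs_nonneg _
    exact Finset.biUnion_subset.2 fun i _ => Finset.filter_subset _ _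
  · intro i _ j _ hij
    rw [Function.onFun, Finset.disjoint_left]
    intro a ha hb
    exact hij (hI.eq_of_mem (Finset.mem_filter.1 ha).2 (Finset.mem_filter.1 hb).2)

section Iter

variable (N : ℕ → ℕ)

lemma mixedIter_nonneg (k : ℕ) (x : ℕ →₀ ℝ) : 0 ≤ mixedIter N k x := by
  induction k with
  | zero => exact Real.iSup_nonneg fun _ => abs_nonneg _
  | succ k ih => exact le_max_of_le_left ih

lemma half_pow_mul_sum_le {I : ℕ → Finset ℕ} (hI : IsSuccessive I) (j : ℕ) (B : Finset ℕ)
    (x : ℕ →₀ ℝ) {p : (ℕ →₀ ℝ) → ℝ} (hp : ∀ x : ℕ →₀ ℝ, p x ≤ ∑ a ∈ x.support, |x a|) :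
    (1 / 2 : ℝ) ^ j * ∑ i ∈ B, p (x.filter (· ∈ I i)) ≤ (1 / 2) ^ j * ∑ a ∈ x.support, |x a| := by
  gcongr
  exact (Finset.sum_le_sum fun i _ => hp _).trans (sum_abs_filter_le hI B x)

lemma half_pow_mul_le {c : ℝ} (hc : 0 ≤ c) (j : ℕ) : (1 / 2 : ℝ) ^ j * c ≤ c :=
  mul_le_of_le_one_left hc (pow_le_one₀ (by norm_num) (by norm_num))

lemma mixedIter_le_l1 (k : ℕ) (x : ℕ →₀ ℝ) :
    mixedIter N k x ≤ ∑ a ∈ x.support, |x a| := by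
  induction k generalizing x with
  | zero => exact tsirelsonIter_le_l1 0 x
  | succ k ih =>
    have h3 : 0 ≤ ∑ a ∈ x.support, |x a| := by positivity
    exact max_le (ih x) (Real.iSup_le
      (fun F => (half_pow_mul_sum_le F.2.2 _ _ x ih).trans (half_pow_mul_le h3 _)) h3)

lemma bddAbove_blockFamily (k : ℕ) (x : ℕ →₀ ℝ) :
    BddAbove (Set.range fun F : BlockFamily N =>
      (1 / 2 : ℝ) ^ (F.1.1 + 1) *
        ∑ i ∈ F.1.2.1, mixedIter N k (x.filter (· ∈ F.1.2.2 i))) := by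
  refine ⟨∑ a ∈ x.support, |x a|, ?_⟩
  rintro _ ⟨F, rfl⟩
  exact (half_pow_mul_sum_le F.2.2 _ _ x (mixedIter_le_l1 N k)).trans
    (half_pow_mul_le (by positivity) _)

lemma bddAbove_mixedIter (x : ℕ →₀ ℝ) : BddAbove (Set.range fun k => mixedIter N k x) := by
  refine ⟨∑ a ∈ x.support, |x a|, ?_⟩
  rintro _ ⟨k, rfl⟩
  exact mixedIter_le_l1 N k x

lemma mixedIter_mono (x : ℕ →₀ ℝ) : Monotone fun k => mixedIter N k x :=
  monotone_nat_of_le_succ fun _ => le_max_left _ _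

lemma mixedIter_le_norm (k : ℕ) (x : ℕ →₀ ℝ) : mixedIter N k x ≤ mixedNorm N x :=
  le_ciSup (bddAbove_mixedIter N x) k

lemma mixedNorm_le_l1 (x : ℕ →₀ ℝ) : mixedNorm N x ≤ ∑ a ∈ x.support, |x a| :=
  ciSup_le fun k => mixedIter_le_l1 N k x

lemma abs_coord_le_mixedNorm (x : ℕ →₀ ℝ) (i : ℕ) : |x i| ≤ mixedNorm N x :=
  (le_ciSup (bddAbove_coord x) i).trans (mixedIter_le_norm N 0 x)

lemma mixedNorm_nonneg (x : ℕ →₀ ℝ) : 0 ≤ mixedNorm N x :=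
  (abs_nonneg _).trans (abs_coord_le_mixedNorm N x 0)

-- One half of the implicit equation of the norm: the estimate at each finite stage passes to the
-- limit. The other half is `mixedNorm_le`.
variable {N} in
lemma sum_mixedNorm_filter_le {j : ℕ} {B : Finset ℕ} {I : ℕ → Finset ℕ} (hB : B.card ≤ N j)
    (hI : IsSuccessive I) (x : ℕ →₀ ℝ) :
    (1 / 2 : ℝ) ^ (j + 1) * ∑ i ∈ B, mixedNorm N (x.filter (· ∈ I i)) ≤ mixedNorm N x := by
  have h : Tendsto
      (fun k => (1 / 2 : ℝ) ^ (j + 1) * ∑ i ∈ B, mixedIter N k (x.filter (· ∈ I i))) atTop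
      (𝓝 ((1 / 2) ^ (j + 1) * ∑ i ∈ B, mixedNorm N (x.filter (· ∈ I i)))) :=
    (tendsto_finsetSum _ fun i _ =>
      tendsto_atTop_ciSup (mixedIter_mono N _) (bddAbove_mixedIter N _)).const_mul _
  refine le_of_tendsto' h fun k => le_trans ?_ (mixedIter_le_norm N (k + 1) x)
  exact le_max_of_le_right (le_ciSup (bddAbove_blockFamily N k x) ⟨⟨j, B, I⟩, hB, hI⟩)

variable {N} in
lemma mixedNorm_le {x : ℕ →₀ ℝ} {M : ℝ} (h0 : ∀ i, |x i| ≤ M)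
    (h1 : ∀ (j : ℕ) (B : Finset ℕ) (I : ℕ → Finset ℕ), B.card ≤ N j → IsSuccessive I →
      (1 / 2 : ℝ) ^ (j + 1) * ∑ i ∈ B, mixedNorm N (x.filter (· ∈ I i)) ≤ M) :
    mixedNorm N x ≤ M := by
  refine ciSup_le fun k => ?_
  induction k with
  | zero => exact ciSup_le h0
  | succ k ih =>
    refine max_le ih (Real.iSup_le (fun F => ?_) ((abs_nonneg _).trans (h0 0)))
    refine le_trans ?_ (h1 F.1.1 F.1.2.1 F.1.2.2 F.2.1 F.2.2)
    gcongr
    exact mixedIter_le_norm _ _ _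

lemma mixedIter_smul (k : ℕ) (c : ℝ) (x : ℕ →₀ ℝ) :
    mixedIter N k (c • x) = |c| * mixedIter N k x := by
  induction k generalizing x with
  | zero => exact tsirelsonIter_smul 0 c x
  | succ k ih =>
    simp only [mixedIter, Finsupp.filter_smul, ih]
    rw [mul_max_of_nonneg _ _ (abs_nonneg c), Real.mul_iSup_of_nonneg (abs_nonneg c)]
    congr 2
    funext F
    rw [← Finset.mul_sum]
    ring

lemma mixedIter_add_le (k : ℕ) (x y : ℕ →₀ ℝ) :
    mixedIter N k (x + y) ≤ mixedIter N k x + mixedIter N k y := by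
  induction k generalizing x y with
  | zero => exact tsirelsonIter_add_le 0 x y
  | succ k ih =>
    refine max_le ((ih x y).trans (add_le_add (le_max_left _ _) (le_max_left _ _))) ?_
    refine Real.iSup_le (fun F => ?_)
      (add_nonneg (mixedIter_nonneg N (k + 1) x) (mixedIter_nonneg N (k + 1) y))
    have hx := (le_ciSup (bddAbove_blockFamily N k x) F).trans (le_max_right (mixedIter N k x) _)
    have hy := (le_ciSup (bddAbove_blockFamily N k y) F).trans (le_max_right (mixedIter N k y) _)
    refine le_trans ?_ (add_le_add hx hy)
    rw [← mul_add, ← Finset.sum_add_distrib]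
    gcongr
    rw [Finsupp.filter_add]
    exact ih _ _

/-- Restrictions commute, so the bound passes through the recursion. It makes every coordinate
projection a contraction. -/
lemma mixedIter_filter_le (k : ℕ) (x : ℕ →₀ ℝ) (p : ℕ → Prop) [DecidablePred p] :
    mixedIter N k (x.filter p) ≤ mixedIter N k x := by
  induction k generalizing x with
  | zero =>
    refine ciSup_le fun i => le_trans ?_ (le_ciSup (bddAbove_coord x) i)
    rw [Finsupp.filter_apply]
    split_ifs <;> simp
  | succ k ih =>
    refine max_le_max (ih x) (ciSup_mono (bddAbove_blockFamily N k x) fun F => ?_)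
    gcongr with i
    have : (x.filter p).filter (· ∈ F.1.2.2 i) = (x.filter (· ∈ F.1.2.2 i)).filter p := by
      ext a
      simp only [Finsupp.filter_apply]
      split_ifs <;> rfl
    rw [this]
    exact ih _

lemma mixedNorm_smul (c : ℝ) (x : ℕ →₀ ℝ) : mixedNorm N (c • x) = |c| * mixedNorm N x := by
  simp only [mixedNorm, mixedIter_smul]
  exact (Real.mul_iSup_of_nonneg (abs_nonneg c) _).symm

lemma mixedNorm_add_le (x y : ℕ →₀ ℝ) : mixedNorm N (x + y) ≤ mixedNorm N x + mixedNorm N y :=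
  ciSup_le fun k => (mixedIter_add_le N k x y).trans
    (add_le_add (mixedIter_le_norm N k x) (mixedIter_le_norm N k y))

lemma mixedNorm_filter_le (x : ℕ →₀ ℝ) (p : ℕ → Prop) [DecidablePred p] :
    mixedNorm N (x.filter p) ≤ mixedNorm N x :=
  ciSup_le fun k => (mixedIter_filter_le N k x p).trans (mixedIter_le_norm N k x)

end Iter

/-! ### The normed space, its coordinate functionals and restriction operators -/

/-- `c₀₀`, as the carrier of the mixed Tsirelson norm. -/
def MixedPre (_N : ℕ → ℕ) : Type := ℕ →₀ ℝ

section MixedPre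

variable {N : ℕ → ℕ}

noncomputable instance : AddCommGroup (MixedPre N) := inferInstanceAs (AddCommGroup (ℕ →₀ ℝ))

noncomputable instance : Module ℝ (MixedPre N) := inferInstanceAs (Module ℝ (ℕ →₀ ℝ))

noncomputable instance : Norm (MixedPre N) := ⟨fun x => mixedNorm N x⟩

theorem mixedPre_core : NormedSpace.Core ℝ (MixedPre N) where
  norm_nonneg x := mixedNorm_nonneg N x
  norm_smul c x := mixedNorm_smul N c x
  norm_triangle x y := mixedNorm_add_le N x y
  norm_eq_zero_iff x := by
    constructor
    · intro h
      refine Finsupp.ext fun i => abs_nonpos_iff.1 ?_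
      exact (abs_coord_le_mixedNorm N x i).trans h.le
    · rintro rfl
      have h := mixedNorm_smul N 0 (0 : ℕ →₀ ℝ)
      rw [zero_smul, abs_zero, zero_mul] at h
      exact h

noncomputable instance : NormedAddCommGroup (MixedPre N) :=
  NormedAddCommGroup.ofCore mixedPre_core

noncomputable instance : NormedSpace ℝ (MixedPre N) := NormedSpace.ofCore mixedPre_core

/-- The unit vector `e_i`. -/
noncomputable def mixedUnit (N : ℕ → ℕ) (i : ℕ) : MixedPre N := (Finsupp.single i 1 : ℕ →₀ ℝ)

/-- The coordinate functional `e_i^*`. -/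
noncomputable def mixedCoord (N : ℕ → ℕ) (i : ℕ) : StrongDual ℝ (MixedPre N) :=
  LinearMap.mkContinuous (Finsupp.lapply i : (ℕ →₀ ℝ) →ₗ[ℝ] ℝ) 1 fun x => by
    rw [one_mul]
    exact abs_coord_le_mixedNorm N x i

/-- Restriction of a vector to the coordinates satisfying `p`. -/
noncomputable def mixedRestrict (N : ℕ → ℕ) (p : ℕ → Prop) [DecidablePred p] :
    MixedPre N →L[ℝ] MixedPre N :=
  LinearMap.mkContinuous
    ({ toFun := fun x => x.filter p
       map_add' := fun _ _ => Finsupp.filter_add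
       map_smul' := fun _ _ => Finsupp.filter_smul } : (ℕ →₀ ℝ) →ₗ[ℝ] (ℕ →₀ ℝ)) 1 fun x => by
    rw [one_mul]
    exact mixedNorm_filter_le N x p

lemma mixedPre_ext {x y : MixedPre N} (h : ∀ i, mixedCoord N i x = mixedCoord N i y) : x = y :=
  Finsupp.ext h

lemma abs_mixedCoord_le (i : ℕ) (x : MixedPre N) : |mixedCoord N i x| ≤ ‖x‖ :=
  abs_coord_le_mixedNorm N x i

lemma mixedCoord_restrict (i : ℕ) (p : ℕ → Prop) [DecidablePred p] (x : MixedPre N) :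
    mixedCoord N i (mixedRestrict N p x) = if p i then mixedCoord N i x else 0 :=
  Finsupp.filter_apply _ _ _

lemma mixedCoord_unit (i j : ℕ) : mixedCoord N i (mixedUnit N j) = if j = i then 1 else 0 :=
  Finsupp.single_apply

lemma norm_mixedRestrict_apply_le (p : ℕ → Prop) [DecidablePred p] (x : MixedPre N) :
    ‖mixedRestrict N p x‖ ≤ ‖x‖ := mixedNorm_filter_le N x p

lemma norm_comp_mixedRestrict_le (f : StrongDual ℝ (MixedPre N)) (p : ℕ → Prop)
    [DecidablePred p] : ‖f.comp (mixedRestrict N p)‖ ≤ ‖f‖ :=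
  ContinuousLinearMap.opNorm_le_bound _ (norm_nonneg _) fun x =>
    (f.le_opNorm _).trans (by gcongr; exact norm_mixedRestrict_apply_le p x)

lemma norm_mixedUnit (i : ℕ) : ‖mixedUnit N i‖ = 1 := by
  refine le_antisymm ?_ ?_
  · refine (mixedNorm_le_l1 N (Finsupp.single i 1)).trans ?_
    simp [Finsupp.support_single]
  · have := abs_mixedCoord_le i (mixedUnit N i)
    simpa [mixedCoord_unit] using this

lemma norm_mixedCoord (i : ℕ) : ‖mixedCoord N i‖ = 1 := by
  refine le_antisymm (ContinuousLinearMap.opNorm_le_bound _ zero_le_one fun x => ?_) ?_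
  · rw [one_mul]
    exact abs_mixedCoord_le i x
  · have := (mixedCoord N i).le_opNorm (mixedUnit N i)
    simpa [mixedCoord_unit, norm_mixedUnit] using this

lemma sum_norm_restrict_le {j : ℕ} {B : Finset ℕ} {I : ℕ → Finset ℕ} (hB : B.card ≤ N j)
    (hI : IsSuccessive I) (x : MixedPre N) :
    ∑ i ∈ B, ‖mixedRestrict N (· ∈ I i) x‖ ≤ 2 ^ (j + 1) * ‖x‖ := by
  have h : (1 / 2 : ℝ) ^ (j + 1) * ∑ i ∈ B, ‖mixedRestrict N (· ∈ I i) x‖ ≤ ‖x‖ :=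
    sum_mixedNorm_filter_le hB hI x
  calc ∑ i ∈ B, ‖mixedRestrict N (· ∈ I i) x‖
      = 2 ^ (j + 1) * ((1 / 2 : ℝ) ^ (j + 1) * ∑ i ∈ B, ‖mixedRestrict N (· ∈ I i) x‖) := by
        rw [← mul_assoc, ← mul_pow]; norm_num
    _ ≤ _ := by gcongr

lemma mixedPre_norm_le {x : MixedPre N} {M : ℝ} (h0 : ∀ i, |mixedCoord N i x| ≤ M)
    (h1 : ∀ (j : ℕ) (B : Finset ℕ) (I : ℕ → Finset ℕ), B.card ≤ N j → IsSuccessive I →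
      (1 / 2 : ℝ) ^ (j + 1) * ∑ i ∈ B, ‖mixedRestrict N (· ∈ I i) x‖ ≤ M) : ‖x‖ ≤ M :=
  mixedNorm_le h0 h1

/-- Every vector is supported by an initial segment. -/
lemma exists_mixedCoord_eq_zero (x : MixedPre N) : ∃ m, ∀ i, m ≤ i → mixedCoord N i x = 0 := by
  obtain ⟨m, hm⟩ := (Finsupp.support (show ℕ →₀ ℝ from x)).exists_nat_subset_range
  refine ⟨m, fun i hi => Finsupp.notMem_support_iff.1 fun h => ?_⟩
  exact absurd (Finset.mem_range.1 (hm h)) (not_lt.2 hi)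

/-- The `ℓ₁`-norm bounds all the sums in the definition of the norm. -/
lemma exists_sum_norm_restrict_le (x : MixedPre N) :
    ∃ c : ℝ, 0 ≤ c ∧ ∀ (B : Finset ℕ) (I : ℕ → Finset ℕ), IsSuccessive I →
      ∑ i ∈ B, ‖mixedRestrict N (· ∈ I i) x‖ ≤ c :=
  ⟨∑ a ∈ (show ℕ →₀ ℝ from x).support, |(show ℕ →₀ ℝ from x) a|, by positivity, fun B _ hI =>
    (Finset.sum_le_sum fun _ _ => mixedNorm_le_l1 N _).trans (sum_abs_filter_le hI B x)⟩

lemma mixedRestrict_lt_apply (n : ℕ) (x : MixedPre N) :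
    mixedRestrict N (· < n) x = ∑ i ∈ Finset.range n, mixedCoord N i x • mixedUnit N i := by
  refine mixedPre_ext fun i => ?_
  simp [mixedCoord_restrict, map_sum, mixedCoord_unit]

end MixedPre

/-! ### Suppression unconditional sequences that are not equivalent to the basis of `c₀` -/

section Unconditional

variable {V : Type*} [NormedAddCommGroup V] [NormedSpace ℝ V] {v : ℕ → V}

lemma linearCombination_indicator (v : ℕ → V) (B : Finset ℕ) (a : ℕ → ℝ) :
    Finsupp.linearCombination ℝ v (Finsupp.indicator B fun i _ => a i) = ∑ i ∈ B, a i • v i := by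
  rw [Finsupp.linearCombination_apply,
    Finsupp.sum_of_support_subset _ (Finsupp.support_indicator_subset _ _) _
      (by simp)]
  exact Finset.sum_congr rfl fun i hi => by rw [Finsupp.indicator_of_mem hi]

lemma IsOneSuppressionUnconditional.norm_sum_le (h : IsOneSuppressionUnconditional v)
    {A B : Finset ℕ} (hAB : A ⊆ B) (a : ℕ → ℝ) :
    ‖∑ i ∈ A, a i • v i‖ ≤ ‖∑ i ∈ B, a i • v i‖ := by
  have := h (Finsupp.indicator B fun i _ => a i) A
  rw [linearCombination_indicator] at this
  convert this
  rw [← linearCombination_indicator]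
  congr 1
  ext i
  by_cases hi : i ∈ A
  · simp [hi, hAB hi]
  · simp [hi]

lemma IsOneSuppressionUnconditional.norm_sum_le' (h : IsOneSuppressionUnconditional v)
    {A B : Finset ℕ} (hAB : A ⊆ B) : ‖∑ i ∈ A, v i‖ ≤ ‖∑ i ∈ B, v i‖ := by
  simpa using h.norm_sum_le hAB fun _ => 1

/-- Multiplying the coefficients by numbers in `[0, 1]` does not increase the norm. -/
lemma IsOneSuppressionUnconditional.norm_sum_mul_le (h : IsOneSuppressionUnconditional v)
    (B : Finset ℕ) (a t : ℕ → ℝ) (ht0 : ∀ i ∈ B, 0 ≤ t i) (ht1 : ∀ i ∈ B, t i ≤ 1) :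
    -- Take a functional norming the left side and discard the indices where `a i * g (v i)` is
    -- negative. This leaves a sum over a subset with the original coefficients, where suppression
    -- applies.
    ‖∑ i ∈ B, (t i * a i) • v i‖ ≤ ‖∑ i ∈ B, a i • v i‖ := by
  obtain ⟨g, hg1, hg⟩ := exists_dual_vector'' ℝ (∑ i ∈ B, (t i * a i) • v i)
  have hg' : ‖∑ i ∈ B, (t i * a i) • v i‖ = ∑ i ∈ B, t i * (a i * g (v i)) := by
    have hg' : g (∑ i ∈ B, (t i * a i) • v i) = ‖∑ i ∈ B, (t i * a i) • v i‖ := hg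
    rw [← hg', map_sum]
    exact Finset.sum_congr rfl fun i _ => by rw [map_smul, smul_eq_mul, mul_assoc]
  calc ‖∑ i ∈ B, (t i * a i) • v i‖ = ∑ i ∈ B, t i * (a i * g (v i)) := hg'
    _ ≤ ∑ i ∈ B, if 0 ≤ a i * g (v i) then a i * g (v i) else 0 := by
        refine Finset.sum_le_sum fun i hi => ?_
        split_ifs with hs
        · exact mul_le_of_le_one_left hs (ht1 i hi)
        · exact mul_nonpos_of_nonneg_of_nonpos (ht0 i hi) (not_le.1 hs).le
    _ = g (∑ i ∈ B.filter (fun i => 0 ≤ a i * g (v i)), a i • v i) := by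
        rw [Finset.sum_filter, map_sum]
        refine Finset.sum_congr rfl fun i _ => ?_
        split_ifs <;> simp
    _ ≤ ‖g‖ * ‖∑ i ∈ B.filter (fun i => 0 ≤ a i * g (v i)), a i • v i‖ :=
        (le_abs_self _).trans (g.le_opNorm _)
    _ ≤ 1 * ‖∑ i ∈ B, a i • v i‖ :=
        mul_le_mul hg1 (h.norm_sum_le (Finset.filter_subset _ _) a) (norm_nonneg _) zero_le_one
    _ = _ := one_mul _

lemma IsOneSuppressionUnconditional.abs_le (h : IsOneSuppressionUnconditional v)
    (hn : IsNormalized v) (a : ℕ →₀ ℝ) (i : ℕ) :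
    |a i| ≤ ‖Finsupp.linearCombination ℝ v a‖ := by
  by_cases hi : i ∈ a.support
  · have := h.norm_sum_le (Finset.singleton_subset_iff.2 hi) a
    rw [Finset.sum_singleton, norm_smul, hn i, mul_one] at this
    exact this
  · rw [Finsupp.notMem_support_iff.1 hi, abs_zero]
    exact norm_nonneg _

lemma norm_sum_le_card {V : Type*} [NormedAddCommGroup V] {v : ℕ → V} (hn : IsNormalized v) (A : Finset ℕ) : ‖∑ i ∈ A, v i‖ ≤ A.card := by
  refine (norm_sum_le _ _).trans ?_
  simp [hn _]

lemma linearCombination_c0Basis_apply (a : ℕ →₀ ℝ) (i : ℕ) :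
    Finsupp.linearCombination ℝ c0Basis a i = a i := by
  induction a using Finsupp.induction_linear with
  | zero => simp
  | add f g hf hg => rw [map_add, ZeroAtInftyContinuousMap.add_apply, hf, hg, Finsupp.add_apply]
  | single j c =>
    rw [Finsupp.linearCombination_single, ZeroAtInftyContinuousMap.smul_apply]
    have : c0Basis j i = Pi.single (M := fun _ => ℝ) j 1 i := rfl
    rw [this, Finsupp.single_apply, Pi.single_apply]
    by_cases hij : i = j
    · simp [hij]
    · simp [hij, Ne.symm hij]

lemma abs_le_norm_linearCombination_c0Basis (a : ℕ →₀ ℝ) (i : ℕ) :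
    |a i| ≤ ‖Finsupp.linearCombination ℝ c0Basis a‖ := by
  rw [← linearCombination_c0Basis_apply a i]
  exact (Finsupp.linearCombination ℝ c0Basis a).toBCF.norm_coe_le_norm i

lemma norm_linearCombination_c0Basis_le {a : ℕ →₀ ℝ} {c : ℝ} (hc : 0 ≤ c) (h : ∀ i, |a i| ≤ c) :
    ‖Finsupp.linearCombination ℝ c0Basis a‖ ≤ c := by
  rw [← ZeroAtInftyContinuousMap.norm_toBCF_eq_norm]
  refine (BoundedContinuousFunction.norm_le hc).2 fun i => ?_
  exact (congrArg abs (linearCombination_c0Basis_apply a i)).le.trans (h i)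

/-- Homogeneity. Only a positive upper bound `ρ` is required, so a combination of norm zero is no
special case. -/
lemma CDominates.norm_le {W : Type*} [NormedAddCommGroup W] [NormedSpace ℝ W] {w : ℕ → W} {C ρ : ℝ}
    (h : CDominates C v w) (hρ : 0 < ρ) {a : ℕ →₀ ℝ}
    (ha : ‖Finsupp.linearCombination ℝ v a‖ ≤ ρ) :
    ‖Finsupp.linearCombination ℝ w a‖ ≤ C * ρ := by
  have := h (ρ⁻¹ • a) (by
    rw [map_smul, norm_smul, Real.norm_of_nonneg (inv_nonneg.2 hρ.le)]
    rwa [inv_mul_le_iff₀ hρ, mul_one])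
  rw [map_smul, norm_smul, Real.norm_of_nonneg (inv_nonneg.2 hρ.le), inv_mul_le_iff₀ hρ] at this
  linarith

/-- If `v` is not equivalent to the basis of `c₀` then the sums `∑_{i < l} v_i` are unbounded. -/
lemma exists_lt_norm_sum_range (h : IsOneSuppressionUnconditional v) (hn : IsNormalized v)
    (hc0 : ¬ IsEquivalentTo v c0Basis) (R : ℝ) : ∃ l, R < ‖∑ i ∈ Finset.range l, v i‖ := by
  by_contra! hR
  refine hc0 ⟨⟨1, fun a ha => ?_⟩, ⟨R + R, fun a ha => ?_⟩⟩
  · exact norm_linearCombination_c0Basis_le zero_le_one fun i => (h.abs_le hn a i).trans ha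
  · have hle : ∀ i, |a i| ≤ 1 := fun i => (abs_le_norm_linearCombination_c0Basis a i).trans ha
    obtain ⟨n, hsub⟩ := a.support.exists_nat_subset_range
    have key : ∀ t : ℕ → ℝ, (∀ i, 0 ≤ t i) → (∀ i, t i ≤ 1) →
        ‖∑ i ∈ Finset.range n, t i • v i‖ ≤ R := by
      intro t h0 h1
      refine le_trans ?_ (hR n)
      simpa using h.norm_sum_mul_le (Finset.range n) (fun _ => 1) t (fun i _ => h0 i)
        fun i _ => h1 i
    -- Multipliers must lie in `[0, 1]`, so positive and negative parts are treated separately;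
    -- hence the constant `R + R`.
    have hsplit : Finsupp.linearCombination ℝ v a
        = ∑ i ∈ Finset.range n, max (a i) 0 • v i - ∑ i ∈ Finset.range n, max (-a i) 0 • v i := by
      rw [Finsupp.linearCombination_apply, Finsupp.sum_of_support_subset _ hsub _ (by simp),
        ← Finset.sum_sub_distrib]
      refine Finset.sum_congr rfl fun i _ => ?_
      rw [← sub_smul]
      congr 1
      rcases le_total 0 (a i) with h | h
      · rw [max_eq_left h, max_eq_right (by linarith)]; ring
      · rw [max_eq_right h, max_eq_left (by linarith)]; ring
    rw [hsplit]
    refine (norm_sub_le _ _).trans (add_le_add (key _ ?_ ?_) (key _ ?_ ?_))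
    · exact fun i => le_max_right _ _
    · exact fun i => max_le ((le_abs_self _).trans (hle i)) zero_le_one
    · exact fun i => le_max_right _ _
    · exact fun i => max_le ((neg_le_abs _).trans (hle i)) zero_le_one

lemma sum_range_count_nth {M : Type*} [AddCommMonoid M] (p : ℕ → Prop) [DecidablePred p]
    (g : ℕ → M) (n : ℕ) :
    ∑ i ∈ Finset.range (Nat.count p n), g (Nat.nth p i) = ∑ a ∈ Finset.range n with p a, g a := by
  induction n with
  | zero => simp
  | succ n ih =>
    rw [Nat.count_succ, Finset.range_add_one, Finset.filter_insert]
    split_ifs with hp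
    · rw [Finset.sum_range_succ, ih, Nat.nth_count hp, Finset.sum_insert (by simp), add_comm]
    · exact ih

/-- The sums `∑_{i ∈ A} v_i` tend to infinity in norm, uniformly in the cardinality of `A`. -/
lemma exists_card_le_of_norm_sum_le (h : IsOneSuppressionUnconditional v) (hn : IsNormalized v)
    (hsub : ∀ k : ℕ → ℕ, StrictMono k → Dominates (v ∘ k) v)
    (hc0 : ¬ IsEquivalentTo v c0Basis) (R : ℝ) :
    ∃ M : ℕ, ∀ A : Finset ℕ, ‖∑ i ∈ A, v i‖ ≤ R → A.card ≤ M := by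
  classical
  by_contra! hR
  have hR0 : 0 ≤ R := by
    obtain ⟨A, hA, -⟩ := hR 0
    exact (norm_nonneg _).trans hA
  -- Gliding hump: beyond any `p` there is a set whose sum stays bounded by `R`, but with so many
  -- elements that the initial sum of the same length is huge. Starting with more than `l + (p + 1)`
  -- elements leaves more than `l` after removing those up to `p`.
  have hstep : ∀ p m : ℕ, ∃ A : Finset ℕ, A.Nonempty ∧ (∀ a ∈ A, p < a) ∧
      ‖∑ i ∈ A, v i‖ ≤ R ∧ m * (R + p + 1) < ‖∑ i ∈ Finset.range A.card, v i‖ := by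
    intro p m
    obtain ⟨l, hl⟩ := exists_lt_norm_sum_range h hn hc0 (m * (R + p + 1))
    obtain ⟨A, hA, hcard⟩ := hR (l + (p + 1))
    have hlow : (A.filter (· ≤ p)).card ≤ p + 1 := by
      refine (Finset.card_le_card (t := Finset.range (p + 1)) fun a ha => ?_).trans_eq
        (Finset.card_range _)
      simp only [Finset.mem_filter, Finset.mem_range] at ha ⊢
      omega
    have hsum := Finset.card_filter_add_card_filter_not (s := A) (fun a => a ≤ p)
    simp only [not_le] at hsum
    have hhigh : l < (A.filter (p < ·)).card := by omega
    refine ⟨A.filter (p < ·), Finset.card_pos.1 (by omega), fun a ha => (Finset.mem_filter.1 ha).2,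
      (h.norm_sum_le' (Finset.filter_subset _ _)).trans hA, hl.trans_le (h.norm_sum_le' ?_)⟩
    exact Finset.range_subset_range.2 hhigh.le
  choose A hAne hAgt hAR hAbig using hstep
  obtain ⟨q, hq⟩ : ∃ q : ℕ → ℕ, ∀ m, q (m + 1) = (A (q m) m).sup id :=
    ⟨fun m => Nat.rec 0 (fun m p => (A p m).sup id) m, fun m => rfl⟩
  have hAle : ∀ m, ∀ a ∈ A (q m) m, a ≤ q (m + 1) := fun m a ha => by
    rw [hq]; exact Finset.le_sup (f := id) ha
  have hqmono : StrictMono q := strictMono_nat_of_lt_succ fun m => by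
    obtain ⟨a, ha⟩ := hAne (q m) m
    exact (hAgt _ _ a ha).trans_le (hAle m a ha)
  -- The subsequence contradicting `hsub` enumerates the union of the chosen sets.
  let S : ℕ → Prop := fun a => ∃ m, a ∈ A (q m) m
  have hSinf : (Set.ofPred S).Infinite := by
    refine Set.infinite_of_forall_exists_gt fun n => ?_
    obtain ⟨a, ha⟩ := hAne (q n) n
    exact ⟨a, ⟨n, ha⟩, (hqmono.le_apply).trans_lt (hAgt _ _ a ha)⟩
  obtain ⟨C, hC⟩ := hsub (Nat.nth S) (Nat.nth_strictMono hSinf)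
  obtain ⟨m, hm⟩ := exists_nat_ge C
  have hρ : 0 < R + q m + 1 := by positivity
  set l := Nat.count S (q (m + 1) + 1) with hl
  have hAsub : A (q m) m ⊆ (Finset.range (q (m + 1) + 1)).filter S := fun a ha =>
    Finset.mem_filter.2 ⟨Finset.mem_range.2 (Nat.lt_succ_of_le (hAle m a ha)), m, ha⟩
  have hcardl : (A (q m) m).card ≤ l := by
    rw [hl, Nat.count_eq_card_filter_range]
    exact Finset.card_le_card hAsub
  have hrest : (Finset.range (q (m + 1) + 1)).filter S \ A (q m) m ⊆ Finset.range (q m + 1) := by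
    intro a ha
    simp only [Finset.mem_sdiff, Finset.mem_filter, Finset.mem_range] at ha ⊢
    obtain ⟨⟨ha1, m', ha2⟩, ha3⟩ := ha
    rcases lt_trichotomy m' m with hlt | rfl | hgt
    · exact Nat.lt_succ_of_le ((hAle m' a ha2).trans (hqmono.monotone hlt))
    · exact absurd ha2 ha3
    · have h1 := hAgt _ _ a ha2
      have h2 := hqmono.monotone (Nat.succ_le_of_lt hgt)
      simp only [Nat.succ_eq_add_one] at h2
      omega
  -- The `m`-th set contributes at most `R`. The elements chosen before it lie in `[0, q m]`, so the
  -- triangle inequality bounds their sum by `q m + 1`.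
  have hup : ‖∑ i ∈ Finset.range l, (v ∘ Nat.nth S) i‖ ≤ R + q m + 1 := by
    have := sum_range_count_nth S v (q (m + 1) + 1)
    simp only [Function.comp_apply]
    rw [this, ← Finset.sum_sdiff hAsub]
    have h1 := (norm_sum_le_card hn _).trans (Nat.cast_le.2 (Finset.card_le_card hrest))
    rw [Finset.card_range] at h1
    push_cast at h1
    linarith [norm_add_le (∑ i ∈ (Finset.range (q (m + 1) + 1)).filter S \ A (q m) m, v i)
      (∑ i ∈ A (q m) m, v i), hAR (q m) m]
  have hlc : ∀ w : ℕ → V, Finsupp.linearCombination ℝ w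
      (Finsupp.indicator (Finset.range l) fun _ _ => (1 : ℝ)) = ∑ i ∈ Finset.range l, w i :=
    fun w => by simpa using linearCombination_indicator w (Finset.range l) fun _ => 1
  have hdom := hC.norm_le hρ (by rw [hlc]; exact hup)
  rw [hlc] at hdom
  have hbig := (hAbig (q m) m).trans_le (h.norm_sum_le' (Finset.range_subset_range.2 hcardl))
  nlinarith

/-- Vectors of norm at most one have a bounded number of large coordinates. -/
lemma exists_card_filter_le (h : IsOneSuppressionUnconditional v) (hn : IsNormalized v)
    (hsub : ∀ k : ℕ → ℕ, StrictMono k → Dominates (v ∘ k) v)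
    (hc0 : ¬ IsEquivalentTo v c0Basis) {ε : ℝ} (hε : 0 < ε) :
    ∃ M : ℕ, ∀ a : ℕ →₀ ℝ, ‖Finsupp.linearCombination ℝ v a‖ ≤ 1 →
      (a.support.filter fun i => ε < |a i|).card ≤ M := by
  obtain ⟨M, hM⟩ := exists_card_le_of_norm_sum_le h hn hsub hc0 ε⁻¹
  have key : ∀ a : ℕ →₀ ℝ, ‖Finsupp.linearCombination ℝ v a‖ ≤ 1 →
      (a.support.filter fun i => ε < a i).card ≤ M := by
    intro a ha
    refine hM _ ?_
    have h1 := h.norm_sum_le (Finset.filter_subset (fun i => ε < a i) a.support) a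
    -- These multipliers flatten all the large coordinates to the value `ε`.
    have h2 := h.norm_sum_mul_le (a.support.filter fun i => ε < a i) a (fun i => ε * (a i)⁻¹)
      (fun i hi => mul_nonneg hε.le (inv_nonneg.2 (hε.trans (Finset.mem_filter.1 hi).2).le))
      (fun i hi => by
        have := (Finset.mem_filter.1 hi).2
        rw [← div_eq_mul_inv, div_le_one (hε.trans this)]
        exact this.le)
    have h3 : ∑ i ∈ a.support.filter (fun i => ε < a i), (ε * (a i)⁻¹ * a i) • v i
        = ε • ∑ i ∈ a.support.filter (fun i => ε < a i), v i := by
      rw [Finset.smul_sum]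
      refine Finset.sum_congr rfl fun i hi => ?_
      rw [mul_assoc, inv_mul_cancel₀ (hε.trans (Finset.mem_filter.1 hi).2).ne', mul_one]
    rw [h3, norm_smul, Real.norm_of_nonneg hε.le] at h2
    rw [← one_div, le_div_iff₀' hε]
    exact (h2.trans h1).trans ha
  refine ⟨M + M, fun a ha => ?_⟩
  have h1 := key a ha
  have h2 := key (-a) (by rwa [map_neg, norm_neg])
  rw [Finsupp.support_neg] at h2
  refine (Finset.card_le_card fun i hi => ?_).trans
    ((Finset.card_union_le _ _).trans (add_le_add h1 h2))
  obtain ⟨hi, hlt⟩ := Finset.mem_filter.1 hi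
  rcases lt_abs.1 hlt with h | h
  · exact Finset.mem_union_left _ (Finset.mem_filter.2 ⟨hi, h⟩)
  · exact Finset.mem_union_right _ (Finset.mem_filter.2 ⟨hi, h⟩)

end Unconditional

/-! ### The dual of the mixed Tsirelson space -/

section Dual

variable {N : ℕ → ℕ}

lemma mixedRestrict_comp (p q : ℕ → Prop) [DecidablePred p] [DecidablePred q] (x : MixedPre N) :
    mixedRestrict N p (mixedRestrict N q x) = mixedRestrict N (fun i => p i ∧ q i) x := by
  refine mixedPre_ext fun i => ?_
  simp only [mixedCoord_restrict]
  split_ifs <;> simp_all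

lemma mixedRestrict_congr {p q : ℕ → Prop} [DecidablePred p] [DecidablePred q]
    (h : ∀ i, p i ↔ q i) : mixedRestrict N p = mixedRestrict N q := by
  ext x
  refine mixedPre_ext fun i => ?_
  simp only [mixedCoord_restrict, h]

lemma mixedRestrict_eq_self {p : ℕ → Prop} [DecidablePred p] {x : MixedPre N}
    (h : ∀ i, ¬ p i → mixedCoord N i x = 0) : mixedRestrict N p x = x := by
  refine mixedPre_ext fun i => ?_
  rw [mixedCoord_restrict]
  split_ifs with hp
  · rfl
  · exact (h i hp).symm

lemma mixedRestrict_eq_zero {p : ℕ → Prop} [DecidablePred p] {x : MixedPre N}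
    (h : ∀ i, p i → mixedCoord N i x = 0) : mixedRestrict N p x = 0 := by
  refine mixedPre_ext fun i => ?_
  rw [mixedCoord_restrict, map_zero]
  split_ifs with hp
  · exact h i hp
  · rfl

/-- The norm of the part of the functional `f` beyond `n`. -/
lemma norm_comp_tail_antitone (f : StrongDual ℝ (MixedPre N)) :
    Antitone fun n => ‖f.comp (mixedRestrict N (n ≤ ·))‖ := by
  intro m n hmn
  have : f.comp (mixedRestrict N (n ≤ ·))
      = (f.comp (mixedRestrict N (m ≤ ·))).comp (mixedRestrict N (n ≤ ·)) := by
    have hc : mixedRestrict N (n ≤ ·) = mixedRestrict N fun i => m ≤ i ∧ n ≤ i :=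
      mixedRestrict_congr fun i => ⟨fun h => ⟨hmn.trans h, h⟩, fun h => h.2⟩
    ext x
    exact congrArg f ((congrArg (· x) hc).trans (mixedRestrict_comp _ _ x).symm)
  show ‖f.comp (mixedRestrict N (n ≤ ·))‖ ≤ ‖f.comp (mixedRestrict N (m ≤ ·))‖
  rw [this]
  exact norm_comp_mixedRestrict_le _ _

/-- A block sequence of vectors: the support of `y b` precedes the support of `y b'` if
`b < b'`. -/
def IsBlockSequence (y : ℕ → MixedPre N) : Prop :=
  ∀ b b', b < b' → ∀ s t, mixedCoord N s (y b) ≠ 0 → mixedCoord N t (y b') ≠ 0 → s < t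

/-- Only `N j` members of a block sequence meet more than one of the sets `I i`, `i ∈ B`, so that a
successive family acts on long averages almost as it does on a single member. -/
lemma sum_sum_norm_restrict_le {y : ℕ → MixedPre N} (hy : IsBlockSequence y)
    (hy1 : ∀ b, ‖y b‖ ≤ 1) {j : ℕ} {B : Finset ℕ} {I : ℕ → Finset ℕ} (hB : B.card ≤ N j)
    (hI : IsSuccessive I) (r : ℕ) :
    (1 / 2 : ℝ) ^ (j + 1) * ∑ b ∈ Finset.range r, ∑ i ∈ B, ‖mixedRestrict N (· ∈ I i) (y b)‖
      ≤ r / 2 + N j := by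
  classical
  let meets : ℕ → ℕ → Prop := fun b i => ∃ s ∈ I i, mixedCoord N s (y b) ≠ 0
  let bad : ℕ → Prop := fun b => ∃ i ∈ B, ∃ i' ∈ B, i < i' ∧ meets b i ∧ meets b i'
  have hterm : ∀ b, (1 / 2 : ℝ) ^ (j + 1) * ∑ i ∈ B, ‖mixedRestrict N (· ∈ I i) (y b)‖
      ≤ 1 / 2 + if bad b then 1 else 0 := by
    intro b
    split_ifs with hb
    · have := sum_norm_restrict_le hB hI (y b)
      calc (1 / 2 : ℝ) ^ (j + 1) * ∑ i ∈ B, ‖mixedRestrict N (· ∈ I i) (y b)‖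
          ≤ (1 / 2 : ℝ) ^ (j + 1) * (2 ^ (j + 1) * ‖y b‖) := by gcongr
        _ = ‖y b‖ := by rw [← mul_assoc, ← mul_pow]; norm_num
        _ ≤ 1 / 2 + 1 := by linarith [hy1 b]
    · have hsum : ∑ i ∈ B, ‖mixedRestrict N (· ∈ I i) (y b)‖ ≤ 1 := by
        by_cases hex : ∃ i ∈ B, meets b i
        · obtain ⟨i, hi, hmi⟩ := hex
          rw [Finset.sum_eq_single_of_mem i hi]
          · exact (norm_mixedRestrict_apply_le _ _).trans (hy1 b)
          · intro i' hi' hne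
            rw [mixedRestrict_eq_zero, norm_zero]
            intro s hs
            by_contra hs0
            rcases lt_or_gt_of_ne hne with hlt | hlt
            · exact hb ⟨i', hi', i, hi, hlt, ⟨s, hs, hs0⟩, hmi⟩
            · exact hb ⟨i, hi, i', hi', hlt, hmi, ⟨s, hs, hs0⟩⟩
        · rw [Finset.sum_eq_zero]
          · exact zero_le_one
          · intro i hi
            rw [mixedRestrict_eq_zero, norm_zero]
            intro s hs
            by_contra hs0
            exact hex ⟨i, hi, s, hs, hs0⟩
      have hpow : (1 / 2 : ℝ) ^ (j + 1) ≤ 1 / 2 := by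
        rw [pow_succ]
        exact half_pow_mul_le (by norm_num) j
      have h0 : 0 ≤ ∑ i ∈ B, ‖mixedRestrict N (· ∈ I i) (y b)‖ := by positivity
      nlinarith
  have hbad : ((Finset.range r).filter bad).card ≤ N j := by
    refine le_trans ?_ hB
    -- A bad `b` is sent to the smaller index `g b` of two sets it meets. If `g b = g b'` with `b <
    -- b'`, then `y b` meets the set `I (g' b)`, later than the set `I (g b)` met by `y b'`, against
    -- the order of the blocks.
    choose! g hgB g' _ hlt hg hg' using fun b (hb : bad b) => hb
    refine Finset.card_le_card_of_injOn g (fun b hb => hgB b (Finset.mem_filter.1 hb).2) ?_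
    have hne : ∀ b b', bad b → bad b' → b < b' → g b ≠ g b' := by
      intro b b' hb hb' hbb heq
      obtain ⟨s, hs, hs0⟩ := hg' b hb
      obtain ⟨t, ht, ht0⟩ := hg b' hb'
      rw [← heq] at ht
      exact lt_asymm (hy b b' hbb s t hs0 ht0) (hI _ _ (hlt b hb) t ht s hs)
    intro b hb b' hb' heq
    have hb := (Finset.mem_filter.1 hb).2
    have hb' := (Finset.mem_filter.1 hb').2
    rcases lt_trichotomy b b' with h | h | h
    · exact absurd heq (hne b b' hb hb' h)
    · exact h
    · exact absurd heq.symm (hne b' b hb' hb h)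
  rw [Finset.mul_sum]
  refine (Finset.sum_le_sum fun b _ => hterm b).trans ?_
  rw [Finset.sum_add_distrib, ← Finset.sum_filter, Finset.sum_const, Finset.sum_const,
    Finset.card_range, nsmul_eq_mul, nsmul_eq_mul, mul_one]
  have : (((Finset.range r).filter bad).card : ℝ) ≤ N j := by exact_mod_cast hbad
  linarith

/-- The sum of a vector and of a sufficiently long average of later blocks has norm at most `8/5`
if all of them belong to the unit ball. -/
lemma exists_norm_add_average_le {x : MixedPre N} (hx1 : ‖x‖ ≤ 1) :
    ∃ r : ℕ, 0 < r ∧ ∀ y : ℕ → MixedPre N, IsBlockSequence y → (∀ b, ‖y b‖ ≤ 1) →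
      (∀ b s t, mixedCoord N s x ≠ 0 → mixedCoord N t (y b) ≠ 0 → s < t) →
      ‖x + (r : ℝ)⁻¹ • ∑ b ∈ Finset.range r, y b‖ ≤ 8 / 5 := by
  obtain ⟨c, hc0, hc⟩ := exists_sum_norm_restrict_le x
  -- For `j ≥ K` the weight reduces the share of `x` to `3/5`. For `j < K` the length `r ≥ 10 * N j`
  -- reduces that of the average to `1/2 + 1/10`. In each case the other share is at most 1.
  obtain ⟨K, hK⟩ : ∃ K : ℕ, (1 / 2 : ℝ) ^ K * c ≤ 3 / 5 := by
    have h := ((tendsto_pow_atTop_nhds_zero_of_lt_one (r := (1 / 2 : ℝ)) (by norm_num)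
      (by norm_num)).mul_const c)
    rw [zero_mul] at h
    exact (h.eventually (ge_mem_nhds (by norm_num : (0 : ℝ) < 3 / 5))).exists
  let r : ℕ := 10 * (∑ j ∈ Finset.range K, N j) + 1
  have hr : 0 < r := Nat.succ_pos _
  refine ⟨r, hr, fun y hy hy1 hxy => ?_⟩
  have hr' : (0 : ℝ) < r := Nat.cast_pos.2 hr
  set z := (r : ℝ)⁻¹ • ∑ b ∈ Finset.range r, y b with hz
  have hz1 : ‖z‖ ≤ 1 := by
    rw [hz, norm_smul, Real.norm_of_nonneg (inv_nonneg.2 hr'.le), inv_mul_le_iff₀ hr', mul_one]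
    refine (norm_sum_le _ _).trans ((Finset.sum_le_sum fun b _ => hy1 b).trans ?_)
    simp
  refine mixedPre_norm_le (fun i => ?_) fun j B I hB hI => ?_
  · rw [map_add]
    by_cases hi : mixedCoord N i x = 0
    · rw [hi, zero_add]
      linarith [abs_mixedCoord_le i z]
    · have : mixedCoord N i z = 0 := by
        rw [hz, map_smul, map_sum, Finset.sum_eq_zero, smul_zero]
        intro b _
        by_contra hb
        exact lt_irrefl _ (hxy b i i hi hb)
      rw [this, add_zero]
      linarith [abs_mixedCoord_le i x]
  · have hsplit : (1 / 2 : ℝ) ^ (j + 1) * ∑ i ∈ B, ‖mixedRestrict N (· ∈ I i) (x + z)‖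
        ≤ (1 / 2 : ℝ) ^ (j + 1) * ∑ i ∈ B, ‖mixedRestrict N (· ∈ I i) x‖
          + (1 / 2 : ℝ) ^ (j + 1) * ∑ i ∈ B, ‖mixedRestrict N (· ∈ I i) z‖ := by
      rw [← mul_add, ← Finset.sum_add_distrib]
      gcongr with i
      rw [map_add]
      exact norm_add_le _ _
    have hle : ∀ w : MixedPre N,
        (1 / 2 : ℝ) ^ (j + 1) * ∑ i ∈ B, ‖mixedRestrict N (· ∈ I i) w‖ ≤ ‖w‖ := fun w =>
      sum_mixedNorm_filter_le hB hI w
    refine hsplit.trans ?_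
    rcases lt_or_ge j K with hj | hj
    · have hNj : (10 : ℝ) * N j ≤ r := by
        have : 10 * N j ≤ r := by
          have := Finset.single_le_sum (f := N) (fun _ _ => Nat.zero_le _) (Finset.mem_range.2 hj)
          simp only [r]
          omega
        exact_mod_cast this
      have hzsum : (1 / 2 : ℝ) ^ (j + 1) * ∑ i ∈ B, ‖mixedRestrict N (· ∈ I i) z‖
          ≤ (r : ℝ)⁻¹ * ((1 / 2 : ℝ) ^ (j + 1) *
            ∑ b ∈ Finset.range r, ∑ i ∈ B, ‖mixedRestrict N (· ∈ I i) (y b)‖) := by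
        rw [Finset.sum_comm, mul_left_comm]
        gcongr
        rw [Finset.mul_sum]
        gcongr with i
        rw [hz, map_smul, norm_smul, Real.norm_of_nonneg (inv_nonneg.2 hr'.le), map_sum]
        gcongr
        exact norm_sum_le _ _
      have havg := sum_sum_norm_restrict_le hy hy1 hB hI r
      have : (r : ℝ)⁻¹ * (r / 2 + N j) ≤ 3 / 5 := by
        rw [inv_mul_le_iff₀ hr']
        linarith
      have h3 := mul_le_mul_of_nonneg_left havg (inv_nonneg.2 hr'.le)
      linarith [hle x]
    · have h1 : (1 / 2 : ℝ) ^ (j + 1) * ∑ i ∈ B, ‖mixedRestrict N (· ∈ I i) x‖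
          ≤ (1 / 2 : ℝ) ^ K * c := by
        refine mul_le_mul ?_ (hc B I hI) (by positivity) (by positivity)
        exact pow_le_pow_of_le_one (by norm_num) (by norm_num) (by omega)
      linarith [hle z]

/-- The unit vector basis of the mixed Tsirelson space is shrinking. -/
theorem tendsto_norm_comp_tail (f : StrongDual ℝ (MixedPre N)) :
    Tendsto (fun n => ‖f.comp (mixedRestrict N (n ≤ ·))‖) atTop (𝓝 0) := by
  have hbdd : BddBelow (Set.range fun n => ‖f.comp (mixedRestrict N (n ≤ ·))‖) :=
    ⟨0, by rintro _ ⟨n, rfl⟩; exact norm_nonneg _⟩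
  have hlim := tendsto_atTop_ciInf (norm_comp_tail_antitone f) hbdd
  set L := ⨅ n, ‖f.comp (mixedRestrict N (n ≤ ·))‖
  have hL0 : 0 ≤ L := le_ciInf fun n => norm_nonneg _
  rcases hL0.eq_or_lt with h | hpos
  · rwa [← h] at hlim
  exfalso
  -- The vector `w` below has `f w ≥ 1.9 L`, while `‖w‖ ≤ 8/5` allows at most `1.05 · 1.6 L = 1.68
  -- L`.
  obtain ⟨n₀, hn₀⟩ : ∃ n, ‖f.comp (mixedRestrict N (n ≤ ·))‖ < 21 / 20 * L :=
    (hlim.eventually (gt_mem_nhds (by linarith))).exists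
  have hex : ∀ n, ∃ y : MixedPre N, ‖y‖ ≤ 1 ∧ (∀ i, mixedCoord N i y ≠ 0 → n ≤ i) ∧
      19 / 20 * L ≤ f y := by
    intro n
    have hlt : 19 / 20 * L < ‖f.comp (mixedRestrict N (n ≤ ·))‖ :=
      lt_of_lt_of_le (by linarith) (ciInf_le hbdd n)
    obtain ⟨x, hx1, hx⟩ := ContinuousLinearMap.exists_lt_apply_of_lt_opNorm _ hlt
    have hsupp : ∀ i, mixedCoord N i (mixedRestrict N (n ≤ ·) x) ≠ 0 → n ≤ i := by
      intro i hi
      rw [mixedCoord_restrict] at hi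
      by_contra h
      exact hi (if_neg h)
    have hnorm := (norm_mixedRestrict_apply_le (n ≤ ·) x).trans hx1.le
    rw [ContinuousLinearMap.comp_apply, Real.norm_eq_abs] at hx
    rcases lt_abs.1 hx with h | h
    · exact ⟨_, hnorm, hsupp, h.le⟩
    · refine ⟨-mixedRestrict N (n ≤ ·) x, by rwa [norm_neg], fun i hi => hsupp i fun h0 => ?_, ?_⟩
      · rw [map_neg, h0, neg_zero] at hi
        exact hi rfl
      · rw [map_neg]
        exact h.le
  choose Y hY1 hYsupp hYf using hex
  choose bound hbound using exists_mixedCoord_eq_zero (N := N)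
  obtain ⟨r, hr, hnorm⟩ := exists_norm_add_average_le (hY1 n₀)
  let m : ℕ → ℕ := fun b => Nat.rec (max n₀ (bound (Y n₀))) (fun _ p => max p (bound (Y p))) b
  have hm0 : m 0 = max n₀ (bound (Y n₀)) := rfl
  have hms : ∀ b, m (b + 1) = max (m b) (bound (Y (m b))) := fun b => rfl
  have hmono : Monotone m := monotone_nat_of_le_succ fun b => by rw [hms]; exact le_max_left _ _
  have hlt : ∀ y : MixedPre N, ∀ i, mixedCoord N i y ≠ 0 → i < bound y := fun y i hi => by
    by_contra h
    exact hi (hbound y i (not_lt.1 h))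
  have hblock : IsBlockSequence fun b => Y (m b) := by
    intro b b' hbb s t hs ht
    have h1 := hlt _ _ hs
    have h2 := hYsupp _ _ ht
    have h3 := hmono (Nat.succ_le_of_lt hbb)
    rw [Nat.succ_eq_add_one, hms] at h3
    exact h1.trans_le ((le_max_right _ _).trans (h3.trans h2))
  have hfirst : ∀ b s t, mixedCoord N s (Y n₀) ≠ 0 → mixedCoord N t (Y (m b)) ≠ 0 → s < t := by
    intro b s t hs ht
    have h1 := hlt _ _ hs
    have h2 := hYsupp _ _ ht
    have h3 := hmono (Nat.zero_le b)
    rw [hm0] at h3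
    exact h1.trans_le ((le_max_right _ _).trans (h3.trans h2))
  have hw := hnorm _ hblock (fun b => hY1 _) hfirst
  set w := Y n₀ + (r : ℝ)⁻¹ • ∑ b ∈ Finset.range r, Y (m b) with hwdef
  have hr' : (0 : ℝ) < r := Nat.cast_pos.2 hr
  have hfw : 19 / 20 * L + 19 / 20 * L ≤ f w := by
    rw [hwdef, map_add, map_smul, map_sum, smul_eq_mul]
    refine add_le_add (hYf _) ?_
    rw [le_inv_mul_iff₀ hr']
    calc (r : ℝ) * (19 / 20 * L) = ∑ b ∈ Finset.range r, 19 / 20 * L := by simp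
      _ ≤ _ := Finset.sum_le_sum fun b _ => hYf _
  have hself : mixedRestrict N (n₀ ≤ ·) w = w := by
    refine mixedRestrict_eq_self fun i hi => ?_
    have h1 : ∀ n, n₀ ≤ n → mixedCoord N i (Y n) = 0 := fun n hn => by
      by_contra h
      exact hi (hn.trans (hYsupp n i h))
    rw [hwdef, map_add, map_smul, map_sum, h1 _ le_rfl, Finset.sum_eq_zero, smul_zero, add_zero]
    exact fun b _ => h1 _ ((le_max_left _ _).trans (hmono (Nat.zero_le b)))
  have hup := (f.comp (mixedRestrict N (n₀ ≤ ·))).le_opNorm w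
  rw [ContinuousLinearMap.comp_apply, hself] at hup
  have h1 := (le_abs_self _).trans hup
  have h2 : ‖f.comp (mixedRestrict N (n₀ ≤ ·))‖ * ‖w‖ ≤ 21 / 20 * L * (8 / 5) :=
    mul_le_mul hn₀.le hw (norm_nonneg _) (by positivity)
  linarith

/-- Upper estimates for block sequences in the dual of the mixed Tsirelson space. -/
lemma norm_sum_smul_comp_restrict_le {f : ℕ → StrongDual ℝ (MixedPre N)} (hf : ∀ i, ‖f i‖ ≤ 1)
    {I : ℕ → Finset ℕ} (hI : IsSuccessive I) {j : ℕ} {B : Finset ℕ} (hB : B.card ≤ N j)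
    {b : ℕ → ℝ} {c : ℝ} (hc : 0 ≤ c) (hb : ∀ i ∈ B, |b i| ≤ c) :
    ‖∑ i ∈ B, b i • (f i).comp (mixedRestrict N (· ∈ I i))‖ ≤ c * 2 ^ (j + 1) := by
  refine ContinuousLinearMap.opNorm_le_bound _ (by positivity) fun x => ?_
  rw [sum_apply]
  calc ‖∑ i ∈ B, (b i • (f i).comp (mixedRestrict N (· ∈ I i))) x‖
      ≤ ∑ i ∈ B, c * ‖mixedRestrict N (· ∈ I i) x‖ := by
        refine (norm_sum_le _ _).trans (Finset.sum_le_sum fun i hi => ?_)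
        rw [smul_apply, norm_smul]
        refine mul_le_mul (hb i hi) ?_ (norm_nonneg _) hc
        refine ((f i).le_opNorm _).trans ?_
        exact mul_le_of_le_one_left (norm_nonneg _) (hf i)
    _ = c * ∑ i ∈ B, ‖mixedRestrict N (· ∈ I i) x‖ := by rw [Finset.mul_sum]
    _ ≤ c * (2 ^ (j + 1) * ‖x‖) := by gcongr; exact sum_norm_restrict_le hB hI x
    _ = _ := by ring

lemma comp_restrict_Ico (f : StrongDual ℝ (MixedPre N)) {m n : ℕ} (hmn : m ≤ n) :
    f.comp (mixedRestrict N (· ∈ Finset.Ico m n))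
      = f - f.comp (mixedRestrict N (· < m)) - f.comp (mixedRestrict N (n ≤ ·)) := by
  ext x
  simp only [sub_apply, ContinuousLinearMap.comp_apply, ← map_sub]
  congr 1
  refine mixedPre_ext fun i => ?_
  simp only [map_sub, mixedCoord_restrict, Finset.mem_Ico]
  by_cases h1 : i < m
  · simp [h1, not_le.2 h1, not_le.2 (h1.trans_le hmn)]
  · by_cases h2 : n ≤ i
    · simp [h1, h2, not_lt.2 h2]
    · simp [h1, h2, not_lt.1 h1, not_le.1 h2]

lemma comp_restrict_lt (f : StrongDual ℝ (MixedPre N)) (n : ℕ) :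
    f.comp (mixedRestrict N (· < n))
      = ∑ i ∈ Finset.range n, f (mixedUnit N i) • mixedCoord N i := by
  ext x
  rw [ContinuousLinearMap.comp_apply, mixedRestrict_lt_apply, map_sum,
    sum_apply]
  refine Finset.sum_congr rfl fun i _ => ?_
  rw [map_smul, smul_apply, smul_eq_mul, smul_eq_mul, mul_comm]

/-! ### Reflexivity of the dual -/

/-- The adjoint of the tail projection. -/
noncomputable def dualTail (N : ℕ → ℕ) (n : ℕ) :
    StrongDual ℝ (MixedPre N) →L[ℝ] StrongDual ℝ (MixedPre N) :=
  LinearMap.mkContinuous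
    { toFun := fun f => f.comp (mixedRestrict N (n ≤ ·))
      map_add' := fun _ _ => rfl
      map_smul' := fun _ _ => rfl } 1 fun f => by
    rw [one_mul]
    exact norm_comp_mixedRestrict_le f _

lemma dualTail_apply (n : ℕ) (f : StrongDual ℝ (MixedPre N)) :
    dualTail N n f = f.comp (mixedRestrict N (n ≤ ·)) := rfl

lemma dualTail_eq_sub (n : ℕ) (f : StrongDual ℝ (MixedPre N)) :
    dualTail N n f = f - f.comp (mixedRestrict N (· < n)) := by
  -- The interval is empty, so head and tail add up to `f`.
  have h := comp_restrict_Ico f (le_refl n)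
  have h0 : f.comp (mixedRestrict N (· ∈ Finset.Ico n n)) = 0 := by
    ext x
    rw [ContinuousLinearMap.comp_apply, mixedRestrict_eq_zero, map_zero]
    · rfl
    · simp
  rw [h0] at h
  exact (sub_eq_zero.1 h.symm).symm

lemma norm_dualTail_apply_le (n : ℕ) (f : StrongDual ℝ (MixedPre N)) : ‖dualTail N n f‖ ≤ ‖f‖ :=
  norm_comp_mixedRestrict_le f _

lemma dualTail_dualTail {m n : ℕ} (hmn : m ≤ n) (f : StrongDual ℝ (MixedPre N)) :
    dualTail N m (dualTail N n f) = dualTail N n f := by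
  have hc : mixedRestrict N (fun i => n ≤ i ∧ m ≤ i) = mixedRestrict N (n ≤ ·) :=
    mixedRestrict_congr fun i => ⟨fun h => h.1, fun h => ⟨h, hmn.trans h⟩⟩
  ext x
  exact congrArg f ((mixedRestrict_comp _ _ x).trans (congrArg (· x) hc))

/-- The biorthogonal functionals form a shrinking basis of the dual. -/
theorem tendsto_norm_comp_dualTail (hN : ∀ j, 4 ^ j ≤ N j)
    (G : StrongDual ℝ (StrongDual ℝ (MixedPre N))) :
    Tendsto (fun n => ‖G.comp (dualTail N n)‖) atTop (𝓝 0) := by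
  have hanti : Antitone fun n => ‖G.comp (dualTail N n)‖ := by
    intro m n hmn
    refine ContinuousLinearMap.opNorm_le_bound _ (norm_nonneg (G.comp (dualTail N m))) fun f => ?_
    rw [ContinuousLinearMap.comp_apply, ← dualTail_dualTail hmn]
    refine ((G.comp (dualTail N m)).le_opNorm _).trans ?_
    gcongr
    exact norm_dualTail_apply_le n f
  rw [Metric.tendsto_atTop]
  by_contra! hcon
  obtain ⟨ε, hε, hcon⟩ := hcon
  have hge : ∀ n, ε ≤ ‖G.comp (dualTail N n)‖ := by
    intro n
    obtain ⟨m, hm, h⟩ := hcon n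
    rw [Real.dist_eq, sub_zero, abs_of_nonneg (norm_nonneg (G.comp (dualTail N m)))] at h
    exact h.trans (hanti hm)
  -- A tail on which `G` exceeds `ε / 2` can be cut off at a finite `m` at a cost below `ε / 4`,
  -- because the tails of `f` tend to zero in norm.
  have hex : ∀ n, ∃ (f : StrongDual ℝ (MixedPre N)) (m : ℕ), ‖f‖ ≤ 1 ∧ n < m ∧
      ε / 4 ≤ G (f.comp (mixedRestrict N (· ∈ Finset.Ico n m))) := by
    intro n
    obtain ⟨f, hf1, hf⟩ := ContinuousLinearMap.exists_lt_apply_of_lt_opNorm (G.comp (dualTail N n))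
      (lt_of_lt_of_le (half_lt_self hε) (hge n))
    obtain ⟨f, hf1, hf⟩ : ∃ f : StrongDual ℝ (MixedPre N), ‖f‖ ≤ 1 ∧ ε / 2 < G (dualTail N n f) := by
      rcases lt_abs.1 hf with h | h
      · exact ⟨f, hf1.le, h⟩
      · refine ⟨-f, by rw [norm_neg]; exact hf1.le, ?_⟩
        rwa [map_neg, map_neg]
    have hlim : Tendsto (fun m => ‖G‖ * ‖f.comp (mixedRestrict N (m ≤ ·))‖) atTop (𝓝 0) := by
      simpa using (tendsto_norm_comp_tail f).const_mul ‖G‖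
    obtain ⟨m, hm, hnm⟩ := ((hlim.eventually (gt_mem_nhds (show 0 < ε / 4 by positivity))).and
      (eventually_gt_atTop n)).exists
    refine ⟨f, m, hf1, hnm, ?_⟩
    have hsplit : f.comp (mixedRestrict N (· ∈ Finset.Ico n m))
        = dualTail N n f - f.comp (mixedRestrict N (m ≤ ·)) := by
      rw [comp_restrict_Ico f hnm.le, dualTail_eq_sub]
    rw [hsplit, map_sub]
    have := (le_abs_self _).trans (G.le_opNorm (f.comp (mixedRestrict N (m ≤ ·))))
    linarith
  choose φ μ hφ1 hμ hφ using hex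
  let m : ℕ → ℕ := fun i => Nat.rec 0 (fun _ p => μ p) i
  have hms : ∀ i, m (i + 1) = μ (m i) := fun i => rfl
  have hmono : StrictMono m := strictMono_nat_of_lt_succ fun i => hμ _
  -- `G` is evaluated at the sum of `4 ^ j` successive blocks. The left side outgrows the right.
  have hbound : ∀ j : ℕ, (4 : ℝ) ^ j * (ε / 4) ≤ ‖G‖ * 2 ^ (j + 1) := by
    intro j
    have hup := norm_sum_smul_comp_restrict_le (f := fun i => φ (m i)) (fun i => hφ1 _)
      (isSuccessive_Ico hmono.monotone) (B := Finset.range (4 ^ j)) (j := j)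
      (by rw [Finset.card_range]; exact hN j) (b := fun _ => 1) zero_le_one (by simp)
    have h1 := (le_abs_self _).trans (G.le_opNorm _) |>.trans
      (mul_le_mul_of_nonneg_left hup (norm_nonneg G))
    rw [map_sum, one_mul] at h1
    refine le_trans ?_ h1
    calc (4 : ℝ) ^ j * (ε / 4) = ∑ i ∈ Finset.range (4 ^ j), ε / 4 := by simp
      _ ≤ _ := Finset.sum_le_sum fun i _ => by
        rw [one_smul]
        exact hφ (m i)
  obtain ⟨j, hj⟩ := pow_unbounded_of_one_lt (8 * ‖G‖ / ε) (one_lt_two (α := ℝ))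
  rw [div_lt_iff₀ hε] at hj
  have h := hbound j
  have h2 : (0 : ℝ) < 2 ^ j := by positivity
  have h4 : (4 : ℝ) ^ j = 2 ^ j * 2 ^ j := by rw [← mul_pow]; norm_num
  rw [h4, pow_succ] at h
  nlinarith

/-- The unit vectors of the dual form a weakly null sequence. -/
lemma isWeaklyNull_mixedCoord (hN : ∀ j, 4 ^ j ≤ N j) : IsWeaklyNull (mixedCoord N) := by
  intro G
  refine squeeze_zero_norm (fun n => ?_) (tendsto_norm_comp_dualTail hN G)
  have h : dualTail N n (mixedCoord N n) = mixedCoord N n := by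
    ext x
    rw [dualTail_apply, ContinuousLinearMap.comp_apply, mixedCoord_restrict, if_pos le_rfl]
  have := (G.comp (dualTail N n)).le_opNorm (mixedCoord N n)
  rwa [ContinuousLinearMap.comp_apply, h, norm_mixedCoord, mul_one] at this

/-- Every functional on the dual is a limit of evaluations. -/
lemma tendsto_sum_inclusionInDoubleDual (hN : ∀ j, 4 ^ j ≤ N j)
    (G : StrongDual ℝ (StrongDual ℝ (MixedPre N))) :
    Tendsto (fun n => NormedSpace.inclusionInDoubleDual ℝ (MixedPre N)
      (∑ i ∈ Finset.range n, G (mixedCoord N i) • mixedUnit N i)) atTop (𝓝 G) := by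
  refine (tendsto_iff_norm_sub_tendsto_zero
    (E := StrongDual ℝ (StrongDual ℝ (MixedPre N)))).2 ?_
  refine (tendsto_norm_comp_dualTail hN G).congr fun n => ?_
  refine (norm_neg (G.comp (dualTail N n))).symm.trans ?_
  congr 1
  ext f
  rw [neg_apply, ContinuousLinearMap.comp_apply, dualTail_eq_sub, comp_restrict_lt,
    sub_apply, NormedSpace.dual_def]
  simp only [map_sub, map_sum, map_smul, smul_eq_mul]
  rw [neg_sub]
  congr 1
  exact Finset.sum_congr rfl fun i _ => mul_comm _ _

/-- A functional `F` on the bidual of `c₀₀` is represented by its composition with the canonical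
embedding: the two agree on evaluations, and every `G` is a norm limit of those. -/
theorem isReflexiveSpace_dual (hN : ∀ j, 4 ^ j ≤ N j) :
    IsReflexiveSpace (StrongDual ℝ (MixedPre N)) := by
  intro F
  refine ⟨F.comp (NormedSpace.inclusionInDoubleDual ℝ (MixedPre N)), ?_⟩
  ext G
  rw [NormedSpace.dual_def]
  have hG := tendsto_sum_inclusionInDoubleDual hN G
  refine tendsto_nhds_unique ?_ ((F.continuous.tendsto G).comp hG)
  have h2 := ((ContinuousLinearMap.apply ℝ ℝ
    (F.comp (NormedSpace.inclusionInDoubleDual ℝ (MixedPre N)))).continuous.tendsto G).comp hG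
  exact h2

/-! ### Growth of sums of unit vectors, and failure of `U_{(t_i^*)}` -/

/-- Sums of unit vectors of the mixed Tsirelson space grow more slowly than linearly. -/
lemma exists_norm_sum_mixedUnit_le (m : ℕ) : ∃ c : ℝ, 0 ≤ c ∧ ∀ A : Finset ℕ,
    ‖∑ i ∈ A, mixedUnit N i‖ ≤ (1 / 2) ^ m * A.card + c := by
  induction m with
  | zero =>
    refine ⟨0, le_rfl, fun A => (norm_sum_le _ _).trans ?_⟩
    simp [norm_mixedUnit]
  | succ m ih =>
    obtain ⟨c, hc, h⟩ := ih
    have hs : ∀ j ∈ Finset.range (m + 1), N j ≤ ∑ j ∈ Finset.range (m + 1), N j :=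
      fun j hj => Finset.single_le_sum (fun _ _ => Nat.zero_le _) hj
    set s := ∑ j ∈ Finset.range (m + 1), N j
    -- The 1 covers the supremum norm. For `j ≤ m` there are at most `s` pieces, each costing `c`,
    -- and the weight, at most `1/2`, halves the slope. For larger `j` the weight alone gives the
    -- new slope.
    refine ⟨1 + c * s, by positivity, fun A => ?_⟩
    have hrestrict : ∀ J : Finset ℕ, mixedRestrict N (· ∈ J) (∑ i ∈ A, mixedUnit N i)
        = ∑ i ∈ A.filter (· ∈ J), mixedUnit N i := by
      intro J
      refine mixedPre_ext fun i => ?_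
      by_cases hi : i ∈ J <;> simp [mixedCoord_restrict, mixedCoord_unit, map_sum, hi]
    refine mixedPre_norm_le (fun i => ?_) fun j B I hB hI => ?_
    · have : |mixedCoord N i (∑ i ∈ A, mixedUnit N i)| ≤ 1 := by
        simp only [map_sum, mixedCoord_unit, Finset.sum_ite_eq']
        split_ifs <;> simp
      have h0 : 0 ≤ (1 / 2 : ℝ) ^ (m + 1) * A.card := by positivity
      have h1 : 0 ≤ c * s := by positivity
      linarith
    · simp only [hrestrict]
      have hcard : (∑ i ∈ B, ((A.filter (· ∈ I i)).card : ℝ)) ≤ A.card := by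
        rw [← Nat.cast_sum, ← Finset.card_biUnion]
        · exact_mod_cast Finset.card_le_card
            (Finset.biUnion_subset.2 fun i _ => Finset.filter_subset _ _)
        · intro i _ j _ hij
          rw [Function.onFun, Finset.disjoint_left]
          intro a ha hb
          exact hij (hI.eq_of_mem (Finset.mem_filter.1 ha).2 (Finset.mem_filter.1 hb).2)
      have hA : (0 : ℝ) ≤ A.card := Nat.cast_nonneg _
      rcases lt_or_ge j (m + 1) with hj | hj
      · have hBs : (B.card : ℝ) ≤ s := by
          exact_mod_cast hB.trans (hs j (Finset.mem_range.2 hj))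
        have hsum : ∑ i ∈ B, ‖∑ i ∈ A.filter (· ∈ I i), mixedUnit N i‖
            ≤ (1 / 2 : ℝ) ^ m * A.card + c * s := by
          refine (Finset.sum_le_sum fun i _ => h _).trans ?_
          rw [Finset.sum_add_distrib, ← Finset.mul_sum, Finset.sum_const, nsmul_eq_mul,
            mul_comm (B.card : ℝ)]
          gcongr
        have hhalf : (1 / 2 : ℝ) ^ (j + 1) ≤ 1 / 2 := by
          rw [pow_succ]
          exact half_pow_mul_le (by norm_num) j
        have hcs : 0 ≤ c * s := by positivity
        calc (1 / 2 : ℝ) ^ (j + 1) * ∑ i ∈ B, ‖∑ i ∈ A.filter (· ∈ I i), mixedUnit N i‖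
            ≤ 1 / 2 * ((1 / 2 : ℝ) ^ m * A.card + c * s) := by gcongr
          _ ≤ _ := by rw [pow_succ]; linarith
      · have hsum : ∑ i ∈ B, ‖∑ i ∈ A.filter (· ∈ I i), mixedUnit N i‖ ≤ A.card := by
          refine (Finset.sum_le_sum fun i _ => ?_).trans hcard
          refine (norm_sum_le _ _).trans ?_
          simp [norm_mixedUnit]
        have hpow : (1 / 2 : ℝ) ^ (j + 1) ≤ (1 / 2) ^ (m + 1) :=
          pow_le_pow_of_le_one (by norm_num) (by norm_num) (by omega)
        have hcs : 0 ≤ 1 + c * s := by positivity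
        calc (1 / 2 : ℝ) ^ (j + 1) * ∑ i ∈ B, ‖∑ i ∈ A.filter (· ∈ I i), mixedUnit N i‖
            ≤ (1 / 2 : ℝ) ^ (m + 1) * A.card := by gcongr
          _ ≤ _ := by linarith

end Dual

/-- The functionals `t_i^*`, `n ≤ i + 1`, generate `c₀` with constant two for sets of size `n`. -/
lemma norm_sum_tsirelsonDualBasis_le {A : Finset ℕ} (hA : ∀ a ∈ A, A.card ≤ a + 1) :
    ‖∑ i ∈ A, tsirelsonDualBasis i‖ ≤ 2 := by
  have hpre : ∀ x : ℕ →₀ ℝ, ∑ i ∈ A, |x i| ≤ 2 * tsirelsonNorm x := by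
    intro x
    -- The singletons of `A`, in increasing order, form an admissible family.
    have h := (isTsirelsonNorm_tsirelsonNorm x).1 (Or.inr ⟨A.card,
      fun t => {A.orderEmbOfFin rfl t}, ⟨?_, ?_⟩, rfl⟩)
    · have h2 : ∑ i ∈ A, |x i|
          ≤ ∑ t, tsirelsonNorm (x.filter (· ∈ ({A.orderEmbOfFin rfl t} : Finset ℕ))) := by
        have : ∑ i ∈ A, |x i| = ∑ t, |x (A.orderEmbOfFin rfl t)| := by
          conv_lhs => rw [← Finset.map_orderEmbOfFin_univ A rfl, Finset.sum_map]
          rfl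
        rw [this]
        refine Finset.sum_le_sum fun t _ => ?_
        refine le_of_eq_of_le ?_ (abs_coord_le_tsirelsonNorm _ (A.orderEmbOfFin rfl t))
        rw [Finsupp.filter_apply_pos _ _ (Finset.mem_singleton_self _)]
      linarith
    · intro t a ha
      rw [Finset.mem_singleton.1 ha]
      exact hA _ (A.orderEmbOfFin_mem rfl t)
    · intro s t hst a ha b hb
      rw [Finset.mem_singleton.1 ha, Finset.mem_singleton.1 hb]
      exact (A.orderEmbOfFin rfl).strictMono hst
  refine ContinuousLinearMap.opNorm_le_bound _ zero_le_two fun x => ?_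
  induction x using UniformSpace.Completion.induction_on with
  | hp => exact isClosed_le (by fun_prop) (by fun_prop)
  | ih x =>
    rw [UniformSpace.Completion.norm_coe, sum_apply]
    refine (Finset.abs_sum_le_sum_abs _ _).trans (le_trans (le_of_eq ?_) (hpre x))
    exact Finset.sum_congr rfl fun i _ => congrArg abs (tsirelsonDualBasis_coe i x)

/-- The witness is the sequence of coordinate functionals, none of whose subsequences is dominated
with the given constant. -/
theorem not_hasU_tsirelsonDualBasis {N : ℕ → ℕ} (hN : ∀ j, 4 ^ j ≤ N j) :
    ¬ HasU tsirelsonDualBasis (StrongDual ℝ (MixedPre N)) := by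
  rintro ⟨C, hC⟩
  obtain ⟨k, hk, hdom⟩ := hC (mixedCoord N) norm_mixedCoord (isWeaklyNull_mixedCoord hN)
  obtain ⟨D, hD, hCD⟩ : ∃ D : ℝ, 0 < D ∧ C ≤ D := ⟨max C 1, by positivity, le_max_left _ _⟩
  -- The final inequality is `n ≤ 2 D (2^{-m} n + c)`. The choice of `m` makes the first term at
  -- most `n / 2`, that of `n` the second smaller than `n / 2`.
  obtain ⟨m, hm⟩ := pow_unbounded_of_one_lt (4 * D) (one_lt_two (α := ℝ))
  obtain ⟨c, hc, h⟩ := exists_norm_sum_mixedUnit_le (N := N) m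
  obtain ⟨n, hn⟩ := exists_nat_gt (4 * D * c)
  -- Exactly `n` indices, all at least `n`, as admissibility requires.
  let A := Finset.Ico n (n + n)
  have hcard : A.card = n := by simp [A]
  have hlc : ∀ {W : Type} [NormedAddCommGroup W] [NormedSpace ℝ W] (w : ℕ → W),
      Finsupp.linearCombination ℝ w (Finsupp.indicator A fun _ _ => (1 : ℝ)) = ∑ i ∈ A, w i :=
    fun w => by simpa using linearCombination_indicator w A fun _ => 1
  have hup := hdom.norm_le zero_lt_two (a := Finsupp.indicator A fun _ _ => (1 : ℝ)) (by
    rw [hlc]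
    refine norm_sum_tsirelsonDualBasis_le fun a ha => ?_
    rw [hcard]
    exact (Finset.mem_Ico.1 ha).1.trans (Nat.le_succ a))
  rw [hlc] at hup
  let A' := A.map ⟨k, hk.injective⟩
  have heval : (∑ i ∈ A, (mixedCoord N ∘ k) i) (∑ i ∈ A', mixedUnit N i) = n := by
    rw [sum_apply]
    rw [Finset.sum_congr rfl (g := fun _ => (1 : ℝ)), Finset.sum_const, hcard, nsmul_eq_mul, mul_one]
    intro i hi
    have : k i ∈ A' := Finset.mem_map_of_mem ⟨k, hk.injective⟩ hi
    simp [map_sum, mixedCoord_unit, this]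
  have h1 := (le_abs_self _).trans ((∑ i ∈ A, (mixedCoord N ∘ k) i).le_opNorm
    (∑ i ∈ A', mixedUnit N i))
  rw [heval] at h1
  have h2 := h A'
  rw [Finset.card_map, hcard] at h2
  have h3 : (n : ℝ) ≤ D * 2 * ((1 / 2) ^ m * n + c) :=
    h1.trans (mul_le_mul (hup.trans (by linarith)) h2 (norm_nonneg _) (by positivity))
  have h4 : D * 4 * (1 / 2) ^ m ≤ 1 := by
    rw [one_div, inv_pow, ← div_eq_mul_inv, div_le_one (by positivity)]
    linarith
  have h5 : (0 : ℝ) ≤ n := Nat.cast_nonneg n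
  nlinarith

/-! ### Upper estimates for weakly null sequences in the dual -/

section Upper

variable {N : ℕ → ℕ}

/-- A weakly null sequence in the ball of the dual has a subsequence close to a block sequence. -/
lemma exists_subseq_near_blocks {f : ℕ → StrongDual ℝ (MixedPre N)} (hf : IsWeaklyNull f) :
    ∃ k m : ℕ → ℕ, StrictMono k ∧ Monotone m ∧ ∀ i,
      ‖f (k i) - (f (k i)).comp (mixedRestrict N (· ∈ Finset.Ico (m i) (m (i + 1))))‖
        ≤ (1 / 2) ^ i := by
  have hinit : ∀ n, Tendsto (fun i => ‖(f i).comp (mixedRestrict N (· < n))‖) atTop (𝓝 0) := by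
    intro n
    have h : Tendsto (fun i => ∑ a ∈ Finset.range n, ‖f i (mixedUnit N a)‖) atTop (𝓝 0) := by
      rw [← Finset.sum_const_zero (s := Finset.range n)]
      refine tendsto_finsetSum _ fun a _ => ?_
      have := hf (NormedSpace.inclusionInDoubleDual ℝ (MixedPre N) (mixedUnit N a))
      simp only [NormedSpace.dual_def] at this
      simpa using this.norm
    refine squeeze_zero (fun i => norm_nonneg ((f i).comp (mixedRestrict N (· < n))))
      (fun i => ?_) h
    rw [comp_restrict_lt]
    refine (norm_sum_le _ _).trans (Finset.sum_le_sum fun a _ => ?_)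
    rw [norm_smul, norm_mixedCoord, mul_one]
  have hk : ∀ k m i : ℕ, ∃ k', k < k' ∧
      ‖(f k').comp (mixedRestrict N (· < m))‖ < (1 / 2) ^ i / 2 := fun k m i =>
    ((eventually_gt_atTop k).and
      ((hinit m).eventually (gt_mem_nhds (by positivity)))).exists
  have hm : ∀ k m i : ℕ, ∃ m', m < m' ∧
      ‖(f k).comp (mixedRestrict N (m' ≤ ·))‖ < (1 / 2) ^ i / 2 := fun k m i =>
    ((eventually_gt_atTop m).and
      ((tendsto_norm_comp_tail (f k)).eventually (gt_mem_nhds (by positivity)))).exists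
  -- `κ` finds a later functional with small head, by weak nullity; `μ` then finds a cut beyond
  -- which its tail is small, by the shrinking property. The recursion tracks the last index and the
  -- last cut.
  choose κ hκ hκ' using hk
  choose μ hμ hμ' using hm
  obtain ⟨s, hs⟩ : ∃ s : ℕ → ℕ × ℕ, ∀ i, s (i + 1) =
      (κ (s i).1 (s i).2 i, μ (κ (s i).1 (s i).2 i) (s i).2 i) :=
    ⟨fun i => Nat.rec (0, 0) (fun i p => (κ p.1 p.2 i, μ (κ p.1 p.2 i) p.2 i)) i, fun _ => rfl⟩
  have hmono : Monotone fun i => (s i).2 := monotone_nat_of_le_succ fun i => by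
    rw [hs]
    exact (hμ _ _ _).le
  refine ⟨fun i => (s (i + 1)).1, fun i => (s i).2, strictMono_nat_of_lt_succ fun i => ?_, hmono,
    fun i => ?_⟩
  · rw [hs (i + 1)]
    exact hκ _ _ _
  · rw [comp_restrict_Ico _ (hmono (Nat.le_succ i)), sub_sub, sub_sub_cancel]
    refine (norm_add_le _ _).trans ?_
    have h1 := hκ' (s i).1 (s i).2 i
    have h2 := hμ' (κ (s i).1 (s i).2 i) (s i).2 i
    simp only [Nat.succ_eq_add_one, hs i]
    linarith

/-- A coefficient sequence with few large coordinates has bounded norm with respect to every block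
sequence of the dual. -/
lemma norm_sum_smul_comp_restrict_le_four {f : ℕ → StrongDual ℝ (MixedPre N)}
    (hf : ∀ i, ‖f i‖ ≤ 1) {I : ℕ → Finset ℕ} (hI : IsSuccessive I) {a : ℕ →₀ ℝ}
    (ha1 : ∀ i, |a i| ≤ 1)
    (ha : ∀ j, (a.support.filter fun i => (1 / 4 : ℝ) ^ (j + 1) < |a i|).card ≤ N j) :
    ‖∑ i ∈ a.support, a i • (f i).comp (mixedRestrict N (· ∈ I i))‖ ≤ 4 := by
  classical
  set g : ℕ → StrongDual ℝ (MixedPre N) := fun i =>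
    a i • (f i).comp (mixedRestrict N (· ∈ I i))
  -- Passing from `J` to `J + 1` adds at most `N J` coefficients of size at most `4^{-J}`, hence
  -- norm at most `2 · 2^{-J}`; the bound is the partial sum of this geometric series.
  have key : ∀ J : ℕ, ‖∑ i ∈ a.support.filter (fun i => (1 / 4 : ℝ) ^ J < |a i|), g i‖
      ≤ 4 - 4 * (1 / 2) ^ J := by
    intro J
    induction J with
    | zero =>
      rw [Finset.filter_false_of_mem fun i _ => ?_]
      · simp
      · simpa using ha1 i
    | succ J ih =>
      have hsub : a.support.filter (fun i => (1 / 4 : ℝ) ^ J < |a i|)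
          ⊆ a.support.filter (fun i => (1 / 4 : ℝ) ^ (J + 1) < |a i|) :=
        Finset.monotone_filter_right _ fun i _ hi => lt_of_le_of_lt
          (pow_le_pow_of_le_one (by norm_num) (by norm_num) (Nat.le_succ J)) hi
      rw [← Finset.sum_sdiff hsub]
      have h := norm_sum_smul_comp_restrict_le hf hI (b := a) (c := (1 / 4) ^ J)
        (B := a.support.filter (fun i => (1 / 4 : ℝ) ^ (J + 1) < |a i|) \
          a.support.filter (fun i => (1 / 4 : ℝ) ^ J < |a i|))
        ((Finset.card_le_card Finset.sdiff_subset).trans (ha J)) (by positivity) (fun i hi => by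
          rw [Finset.mem_sdiff, Finset.mem_filter, Finset.mem_filter] at hi
          by_contra hlt
          exact hi.2 ⟨hi.1.1, not_le.1 hlt⟩)
      have hpow : (1 / 4 : ℝ) ^ J * 2 ^ (J + 1) = 2 * (1 / 2) ^ J := by
        rw [pow_succ, ← mul_assoc, ← mul_pow]
        norm_num
        ring
      rw [hpow] at h
      refine (norm_add_le _ _).trans ((add_le_add h ih).trans (le_of_eq ?_))
      ring
  obtain ⟨J, hJ⟩ : ∃ J : ℕ, ∀ i ∈ a.support, (1 / 4 : ℝ) ^ J < |a i| := by
    have : ∀ᶠ J : ℕ in atTop, ∀ i ∈ a.support, (1 / 4 : ℝ) ^ J < |a i| := by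
      rw [Filter.eventually_all_finset]
      exact fun i hi => (tendsto_pow_atTop_nhds_zero_of_lt_one (by norm_num)
        (by norm_num)).eventually (gt_mem_nhds (abs_pos.2 (Finsupp.mem_support_iff.1 hi)))
    exact this.exists
  have h := key J
  rw [Finset.filter_true_of_mem hJ] at h
  have : (0 : ℝ) ≤ 4 * (1 / 2) ^ J := by positivity
  linarith

/-- The constant 6 is 4 for the block sequence plus `∑ 2^{-i} = 2` for the perturbation, whose
coefficients are at most 1. -/
theorem hasU_dual {V : Type*} [NormedAddCommGroup V] [NormedSpace ℝ V] {v : ℕ → V}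
    (h : IsOneSuppressionUnconditional v) (hn : IsNormalized v)
    (hN : ∀ (j : ℕ) (a : ℕ →₀ ℝ), ‖Finsupp.linearCombination ℝ v a‖ ≤ 1 →
      (a.support.filter fun i => (1 / 4 : ℝ) ^ (j + 1) < |a i|).card ≤ N j) :
    HasU v (StrongDual ℝ (MixedPre N)) := by
  refine ⟨6, fun f hf hf0 => ?_⟩
  obtain ⟨k, m, hk, hm, hclose⟩ := exists_subseq_near_blocks hf0
  refine ⟨k, hk, fun a ha => ?_⟩
  have ha1 : ∀ i, |a i| ≤ 1 := fun i => (h.abs_le hn a i).trans ha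
  have hblock := norm_sum_smul_comp_restrict_le_four (f := fun i => f (k i))
    (fun i => (hf (k i)).le) (isSuccessive_Ico hm) ha1 fun j => hN j a ha
  have hrest : ‖∑ i ∈ a.support, a i • (f (k i) -
      (f (k i)).comp (mixedRestrict N (· ∈ Finset.Ico (m i) (m (i + 1)))))‖ ≤ 2 := by
    refine (norm_sum_le _ _).trans ?_
    rw [← tsum_geometric_two]
    refine (Finset.sum_le_sum fun i _ => ?_).trans
      (summable_geometric_two.sum_le_tsum a.support fun i _ => by positivity)
    rw [norm_smul]
    exact (mul_le_of_le_one_left (norm_nonneg _) (ha1 i)).trans (hclose i)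
  have hsplit : Finsupp.linearCombination ℝ (f ∘ k) a = ∑ i ∈ a.support, a i • (f (k i) -
      (f (k i)).comp (mixedRestrict N (· ∈ Finset.Ico (m i) (m (i + 1)))))
      + ∑ i ∈ a.support, a i • (f (k i)).comp
        (mixedRestrict N (· ∈ Finset.Ico (m i) (m (i + 1)))) := by
    rw [Finsupp.linearCombination_apply, Finsupp.sum, ← Finset.sum_add_distrib]
    refine Finset.sum_congr rfl fun i _ => ?_
    rw [← smul_add, sub_add_cancel, Function.comp_apply]
  rw [hsplit]
  refine (norm_add_le _ _).trans ((add_le_add hrest hblock).trans ?_)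
  norm_num

end Upper

end UpperEstimate

theorem lemma5p7 {V : Type*} [NormedAddCommGroup V] [NormedSpace ℝ V] [CompleteSpace V]
    (v : ℕ → V)
    (hbasic : UpperEstimate.IsBasicSequence v)
    (hnorm : UpperEstimate.IsNormalized v)
    (huncond : UpperEstimate.IsOneSuppressionUnconditional v)
    (hsub : ∀ k : ℕ → ℕ, StrictMono k → UpperEstimate.Dominates (v ∘ k) v)
    (hc0 : ¬ UpperEstimate.IsEquivalentTo v UpperEstimate.c0Basis) :
    ∃ (X : Type) (_ : NormedAddCommGroup X) (_ : NormedSpace ℝ X) (_ : CompleteSpace X),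
      UpperEstimate.IsReflexiveSpace X ∧
      UpperEstimate.HasU v X ∧
      ¬ UpperEstimate.HasU UpperEstimate.tsirelsonDualBasis X := by
  choose M hM using fun j : ℕ => UpperEstimate.exists_card_filter_le huncond hnorm hsub hc0
    (ε := (1 / 4 : ℝ) ^ (j + 1)) (by positivity)
  -- The bound `M j` serves the upper estimates. The bound `4 ^ j` serves reflexivity and the weak
  -- nullity of the coordinate functionals.
  have hN : ∀ j, 4 ^ j ≤ max (4 ^ j) (M j) := fun j => le_max_left _ _
  exact ⟨StrongDual ℝ (UpperEstimate.MixedPre fun j => max (4 ^ j) (M j)), inferInstance,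
    inferInstance, inferInstance, UpperEstimate.isReflexiveSpace_dual hN,
    UpperEstimate.hasU_dual huncond hnorm fun j a ha => (hM j a ha).trans (le_max_right _ _),
    UpperEstimate.not_hasU_tsirelsonDualBasis hN⟩
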